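/- Throughout, $d\ge 1$, $\mathrm{epi}(\gamma)=\{y\in\mathbb R^d: y_d\ge\gamma(y')\}$ and $\mathring{\mathrm{epi}}(\gamma)=\{y\in\mathbb R^d: y_d>\gamma(y')\}$ for $\gamma:\mathbb R^{d-1}\to\mathbb R$, where $y=(y',y_d)$. A point $x\in\partial\Omega$ of the boundary of an open set $\Omega\subset\mathbb R^d$ is a $C^0$ boundary point of $\Omega$ if there are $\delta>0$ and a continuous $\gamma:\mathbb R^{d-1}\to\mathbb R$ such that, up to a rigid motion of $\mathbb R^d$, $\overline\Omega\cap B_\delta(x)=\mathrm{epi}(\gamma)\cap B_\delta(x)$ and $\Omega\cap B_\delta(x)=\mathring{\mathrm{epi}}(\gamma)\cap B_\delta(x)$. For a set $A\subset\mathbb R^d$ that need not be open, $x$ is called a $C^0$ boundary point of $A$ if it is one of $\mathrm{int}\,A$ and $A$ coincides with $\overline{\mathrm{int}\,A}$ in a neighbourhood of $x$. Let $M$ be a paracompact Hausdorff space. A chart is a pair $(U,\phi)$ with $U\subset M$ open and $\phi:U\to\mathbb R^d$ a topological embedding. It is an interior chart if $\phi(U)$ is open in $\mathbb R^d$; it is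 a border chart around $x\in U$ if $\phi$ is defined and a topological embedding on $\overline U$ and $\phi(x)$ is a $C^0$ boundary point of $\phi(U)$. Two charts $(U,\phi)$, $(V,\psi)$ are smoothly compatible if $\psi\circ\phi^{-1}:\phi(U\cap V)\to\psi(U\cap V)$ is the restriction of a $C^\infty$ diffeomorphism between open subsets of $\mathbb R^d$. A $d$-dimensional smooth manifold with kinks is a paracompact Hausdorff space $M$ with a maximal collection of pairwise smoothly compatible interior or border charts that contains, for every $x\in M$, an interior chart or a border chart around $x$. Theorem. Let $M$ be a $d$-dimensional smooth manifold with kinks. Then there is a (paracompact Hausdorff) smooth manifold $\tilde M$ with (possibly empty) boundary, of the same dimension $d$, of which $M$ is a smooth submanifold with kinks, and $M$ lies in the interior of $\tilde M$. That is, there is a topological embedding $j:M\to\tilde M$ with image in the interior of $\tilde M$ such that for every $p\in M$ there is a smooth (interior or border) chart $(V,\psi)$ of $\tilde M$ around $j(p)$ with $\psi(j(p))=0$, such that $0$ is an interior point or a $C^0$ boundary point of $\psi(V\cap j(M))$ and $(j^{-1}(V),\psi\circ j)$ belongs to the maximal atlas of $M$. -/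

import Mathlib

open Set Topology
open scoped Manifold ContDiff

universe u

/-- `ℝᵈ` with its Euclidean norm. -/
abbrev Euc (d : ℕ) : Type := EuclideanSpace ℝ (Fin d)

/-- The first `d - 1` coordinates `y'` of `y ∈ ℝᵈ`. -/
def Euc.front {d : ℕ} (y : Euc d) : Euc (d - 1) :=
  WithLp.toLp 2 fun i => y ⟨i.1, by omega⟩

/-- The last coordinate of `y ∈ ℝᵈ`. -/
def Euc.last {d : ℕ} [NeZero d] (y : Euc d) : ℝ :=
  y ⟨d - 1, Nat.sub_lt (NeZero.pos d) one_pos⟩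

/-- The closed epigraph of `γ : ℝᵈ⁻¹ → ℝ`. -/
def closedEpi {d : ℕ} [NeZero d] (γ : Euc (d - 1) → ℝ) : Set (Euc d) :=
  {y | γ y.front ≤ y.last}

/-- The strict epigraph of `γ : ℝᵈ⁻¹ → ℝ`. -/
def strictEpi {d : ℕ} [NeZero d] (γ : Euc (d - 1) → ℝ) : Set (Euc d) :=
  {y | γ y.front < y.last}

/-- `x` is a `C⁰` boundary point of the open set `Ω ⊆ ℝᵈ`: after a rigid motion `R`, the closure
of `Ω` and `Ω` itself coincide, in a ball around `x`, with the closed and the strict epigraph of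
one continuous function. -/
def IsC0BoundaryPoint {d : ℕ} [NeZero d] (Ω : Set (Euc d)) (x : Euc d) : Prop :=
  x ∈ frontier Ω ∧
  ∃ R : Euc d ≃ᵃⁱ[ℝ] Euc d, ∃ δ > 0, ∃ γ : Euc (d - 1) → ℝ, Continuous γ ∧
    (R '' closure Ω) ∩ Metric.ball (R x) δ = closedEpi γ ∩ Metric.ball (R x) δ ∧
    (R '' Ω) ∩ Metric.ball (R x) δ = strictEpi γ ∩ Metric.ball (R x) δ

/-- The version for a set `A ⊆ ℝᵈ` that need not be open (the image of a border chart):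
`x` is a `C⁰` boundary point of `int A`, and near `x` the set `A` is the closure of `int A`,
so that `A` is near `x`, up to a rigid motion, the closed epigraph of a continuous function. -/
def IsC0BorderPoint {d : ℕ} [NeZero d] (A : Set (Euc d)) (x : Euc d) : Prop :=
  IsC0BoundaryPoint (interior A) x ∧
  ∃ δ > 0, A ∩ Metric.ball x δ = closure (interior A) ∩ Metric.ball x δ

/-- A `d`-dimensional chart of `M`: an open set together with a topological embedding of it
into `ℝᵈ`. The values of `toFun` off the open set are irrelevant. -/
structure EucChart (d : ℕ) (M : Type*) [TopologicalSpace M] where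
  /-- the domain of the chart -/
  source : Set M
  /-- the chart map -/
  toFun : M → Euc d
  open_source : IsOpen source
  isEmbedding_restrict : IsEmbedding (source.domRestrict toFun)

namespace EucChart

section

variable {d : ℕ} {M : Type*} [TopologicalSpace M]

/-- An interior chart: its image is open in `ℝᵈ`. -/
def IsInteriorChart (c : EucChart d M) : Prop :=
  IsOpen (c.toFun '' c.source)

/-- A border chart around `x`: the chart map is a topological embedding even on the closure of
the chart domain, and the image of `x` is a `C⁰` boundary point of the image. -/
def IsBorderChartAt [NeZero d] (c : EucChart d M) (x : M) : Prop :=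
  x ∈ c.source ∧ IsEmbedding ((closure c.source).domRestrict c.toFun) ∧
    IsC0BorderPoint (c.toFun '' c.source) (c.toFun x)

/-- Smooth compatibility of two charts: the transition map between the images of the common
domain is the restriction of a `C^∞` diffeomorphism between open subsets of `ℝᵈ`. -/
def SmoothlyCompatible (c c' : EucChart d M) : Prop :=
  ∃ Φ : OpenPartialHomeomorph (Euc d) (Euc d),
    ContDiffOn ℝ ∞ Φ Φ.source ∧ ContDiffOn ℝ ∞ Φ.symm Φ.target ∧
    c.toFun '' (c.source ∩ c'.source) ⊆ Φ.source ∧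
    ∀ x ∈ c.source ∩ c'.source, Φ (c.toFun x) = c'.toFun x

end

end EucChart

/-- A `d`-dimensional smooth atlas with kinks on `M`: a collection of pairwise smoothly compatible
interior or border charts, such that around every point of `M` there is an interior chart or a
border chart belonging to the collection. -/
structure IsSmoothKinkAtlas {d : ℕ} [NeZero d] {M : Type*} [TopologicalSpace M]
    (A : Set (EucChart d M)) : Prop where
  interior_or_border : ∀ c ∈ A, c.IsInteriorChart ∨ ∃ x, c.IsBorderChartAt x
  compatible : ∀ c ∈ A, ∀ c' ∈ A, c.SmoothlyCompatible c'
  covers : ∀ x, ∃ c ∈ A, (x ∈ c.source ∧ c.IsInteriorChart) ∨ c.IsBorderChartAt x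

/-- The structure of a `d`-dimensional smooth manifold with kinks on the space `M` (which is
assumed to be paracompact and Hausdorff where this is used): a maximal smooth atlas with kinks. -/
structure SmoothKinkStructure (d : ℕ) [NeZero d] (M : Type*) [TopologicalSpace M] where
  /-- the maximal atlas -/
  charts : Set (EucChart d M)
  maximal : Maximal IsSmoothKinkAtlas charts

section ManifoldWithBoundary

variable {d : ℕ} [NeZero d] {N : Type*} [TopologicalSpace N]

/-- A chart of a manifold with boundary, with values in the closed half-space, seen as a chart
with values in `ℝᵈ`. -/
noncomputable def EucChart.ofHalfSpace (f : OpenPartialHomeomorph N (EuclideanHalfSpace d)) :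
    EucChart d N where
  source := f.source
  toFun := f.extend (𝓡∂ d)
  open_source := f.open_source
  isEmbedding_restrict :=
    (𝓡∂ d).isClosedEmbedding.isEmbedding.comp f.isOpenEmbedding_restrict.isEmbedding

/-- The smooth charts (interior charts and border charts) of a smooth manifold with boundary `N`:
those that are smoothly compatible with its atlas. -/
def smoothCharts (d : ℕ) [NeZero d] (N : Type*) [TopologicalSpace N]
    [ChartedSpace (EuclideanHalfSpace d) N] : Set (EucChart d N) :=
  {e | (e.IsInteriorChart ∨ ∃ x, e.IsBorderChartAt x) ∧
    ∀ f ∈ atlas (EuclideanHalfSpace d) N, e.SmoothlyCompatible (EucChart.ofHalfSpace f)}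

end ManifoldWithBoundary

/-- The projection of `ℝᵈ` to its first `k` coordinates. It identifies the slice
`ℝᵏ × {0}ᵈ⁻ᵏ` with `ℝᵏ`. -/
def Euc.proj {k d : ℕ} (hk : k ≤ d) (y : Euc d) : Euc k :=
  WithLp.toLp 2 fun i => y (Fin.castLE hk i)

/-- `e` is a slice chart centered at `p` for the subset `S` of the `d`-dimensional space `N`:
`e` maps `S` into `ℝᵏ × {0}ᵈ⁻ᵏ`, and `e p = 0` is an interior point or a `C⁰` boundary
point of the image of `S`, seen as a subset of `ℝᵏ`. -/
structure EucChart.IsSliceChartAt {k d : ℕ} [NeZero k] (hk : k ≤ d) {N : Type*}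
    [TopologicalSpace N] (e : EucChart d N) (S : Set N) (p : N) : Prop where
  mem_source : p ∈ e.source
  centered : e.toFun p = 0
  slice : ∀ x ∈ e.source ∩ S, ∀ i : Fin d, k ≤ i.1 → e.toFun x i = 0
  interior_or_border :
    (0 : Euc k) ∈ interior ((fun x => Euc.proj hk (e.toFun x)) '' (e.source ∩ S)) ∨
    IsC0BorderPoint ((fun x => Euc.proj hk (e.toFun x)) '' (e.source ∩ S)) 0

/-- `j` realizes the `k`-dimensional smooth manifold with kinks `M` as a smooth submanifold with
kinks of the `d`-dimensional smooth manifold with boundary `N`: it is a topological embedding,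
and around every point of the image there is a slice chart of `N` whose restriction to the image
is one of the charts of the smooth structure of `M`. -/
structure IsSmoothSubmanifoldWithKinks {k d : ℕ} [NeZero k] [NeZero d] (hk : k ≤ d)
    {M : Type*} [TopologicalSpace M] (K : SmoothKinkStructure k M)
    {N : Type*} [TopologicalSpace N] [ChartedSpace (EuclideanHalfSpace d) N]
    (j : M → N) : Prop where
  isEmbedding : IsEmbedding j
  exists_sliceChart : ∀ p : M, ∃ e ∈ smoothCharts d N, e.IsSliceChartAt hk (range j) (j p) ∧
    ∃ c ∈ K.charts, c.source = j ⁻¹' e.source ∧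
      ∀ x ∈ c.source, c.toFun x = Euc.proj hk (e.toFun (j x))

/-! The points of `M` that have an interior chart form an open set, a smooth manifold without
boundary, and this set serves as the ambient manifold. It therefore suffices to embed `M` into its
own interior by a map that, in charts, is locally the restriction of a diffeomorphism between open
subsets of `ℝᵈ`.

Locally, upward translation carries a closed epigraph into the strict one, however irregular the
continuous function `γ` is. Multiplied by a bump function and a small constant, the translation
remains a diffeomorphism, and it extends by the identity to all of `M` (`exists_push`).

Globally, pushes subordinate to a locally finite cover `W` are composed in a fixed order. Each is so
small that a point starting in the shrunken set `closure (O i)` never leaves `W i`, where all but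
finitely many pushes are the identity (`foldr_sort_eq_of_height`). So the infinite composition is
locally a finite one. It is injective and closed, and it ends in the interior, because every point
is in the range of action of some push and local diffeomorphisms preserve the interior
(`exists_isClosedEmbedding_interior`).

If this map reads `Ψ` in charts near `p`, then following the target chart by `Ψ⁻¹` gives a chart in
which the image of `M` looks exactly as `M` does in its own chart, kinks included
(`isSmoothSubmanifoldWithKinks_interior`). -/

/-! ### Diffeomorphisms of `ℝᵈ` close to the identity -/

section Diffeomorphisms

variable {E : Type*} [NormedAddCommGroup E] [NormedSpace ℝ E]

/-- A perturbation of the identity by a smooth contraction is a diffeomorphism. -/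
theorem exists_diffeomorph_add_of_lipschitzWith [CompleteSpace E] {g : E → E} {c : NNReal}
    (hg : ContDiff ℝ ∞ g) (hc : c < 1) (hL : LipschitzWith c g) :
    ∃ Θ : E ≃ₜ E, (∀ z, Θ z = z + g z) ∧ ContDiff ℝ ∞ Θ ∧ ContDiff ℝ ∞ Θ.symm := by
  have happ : ApproximatesLinearOn (fun z => z + g z)
      ((ContinuousLinearEquiv.refl ℝ E : E ≃L[ℝ] E) : E →L[ℝ] E) univ c := by
    intro x _ y _
    have h : x + g x - (y + g y) - (x - y) = g x - g y := by abel
    simpa [h, dist_eq_norm] using hL.dist_le_mul x y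
  -- The trivial space is separate because its identity has norm `0` instead of `1`.
  have hc' : Subsingleton E ∨
      c < ‖((ContinuousLinearEquiv.refl ℝ E).symm : E →L[ℝ] E)‖₊⁻¹ := by
    rcases subsingleton_or_nontrivial E with h | h
    · exact Or.inl h
    · right
      have h1 : ‖((ContinuousLinearEquiv.refl ℝ E).symm : E →L[ℝ] E)‖₊ = 1 := by
        ext
        exact ContinuousLinearMap.norm_id
      rw [h1]
      simpa using hc
  let Θ := happ.toHomeomorph _ hc'
  have hΘ : ∀ z, Θ z = z + g z := fun z => rfl
  have hsm : ContDiff ℝ ∞ Θ := contDiff_id.add hg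
  refine ⟨Θ, hΘ, hsm, ?_⟩
  -- The derivative `1 + Dg = 1 - (-Dg)` is invertible by the Neumann series, which makes the
  -- inverse smooth.
  have hnorm : ∀ z, ‖-(fderiv ℝ g z)‖ < 1 := fun z => by
    rw [norm_neg]
    exact lt_of_le_of_lt (norm_fderiv_le_of_lipschitz ℝ hL) (by exact_mod_cast hc)
  refine Θ.contDiff_symm
    (f₀' := fun z => ContinuousLinearEquiv.unitsEquiv ℝ E (Units.oneSub _ (hnorm z))) ?_ hsm
  intro z
  have h := (hasFDerivAt_id z).add (hg.differentiable (by simp) z).hasFDerivAt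
  refine h.congr_fderiv ?_
  ext w
  change w + fderiv ℝ g z w = (1 - -fderiv ℝ g z : E →L[ℝ] E) w
  simp

/-- Compactly supported pushes in a fixed direction. -/
theorem exists_push_diffeomorph [FiniteDimensional ℝ E] {s t : Set E} (hs : IsCompact s)
    (ht : IsOpen t) (hst : s ⊆ t) (v : E) :
    ∃ ρ : E → ℝ, Continuous ρ ∧ IsCompact (tsupport ρ) ∧ tsupport ρ ⊆ t ∧ (∀ z ∈ s, ρ z = 1) ∧
      (∀ z, ρ z ∈ Icc (0 : ℝ) 1) ∧ ∃ ε₀ > 0, ∀ ε, 0 < ε → ε < ε₀ →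
        ∃ Θ : E ≃ₜ E, (∀ z, Θ z = z + (ε * ρ z) • v) ∧ ContDiff ℝ ∞ Θ ∧ ContDiff ℝ ∞ Θ.symm := by
  obtain ⟨V, hV, hsV, hVt, hVc⟩ := exists_open_between_and_isCompact_closure hs ht hst
  obtain ⟨ρ, hρ, hρr, hρs, hρ1⟩ := exists_contMDiff_support_eq_eq_one_iff
    (n := ⊤) 𝓘(ℝ, E) hV hs.isClosed hsV
  rw [contMDiff_iff_contDiff] at hρ
  have htsupp : tsupport ρ = closure V := by rw [tsupport, hρs]
  have hcs : HasCompactSupport ρ := by rw [HasCompactSupport, htsupp]; exact hVc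
  refine ⟨ρ, hρ.continuous, hcs, htsupp ▸ hVt, fun z hz => (hρ1 z).1 hz,
    fun z => hρr (mem_range_self z), ?_⟩
  have hcs' : HasCompactSupport fun z => ρ z • v := hcs.smul_right
  have hsm : ContDiff ℝ ∞ fun z => ρ z • v := hρ.smul contDiff_const
  obtain ⟨C, hC⟩ := hsm.lipschitzWith_of_hasCompactSupport hcs' (by simp)
  -- Below this bound `ε * C < 1`, so the perturbation is a contraction; the `+ 1` covers `C = 0`.
  refine ⟨1 / (C + 1), by positivity, fun ε hε hε' => ?_⟩
  have hL : LipschitzWith (ε.toNNReal * C) fun z => ε • (ρ z • v) := by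
    refine LipschitzWith.of_dist_le_mul fun x y => ?_
    rw [dist_smul₀, NNReal.coe_mul, Real.coe_toNNReal _ hε.le, Real.norm_of_nonneg hε.le, mul_assoc]
    exact mul_le_mul_of_nonneg_left (hC.dist_le_mul x y) hε.le
  have hlt : ε.toNNReal * C < 1 := by
    rw [← NNReal.coe_lt_coe, NNReal.coe_mul, Real.coe_toNNReal _ hε.le, NNReal.coe_one]
    have h1 : ε * (C + 1) < 1 := (lt_div_iff₀ (by positivity)).1 hε'
    nlinarith
  obtain ⟨Θ, h1, h2, h3⟩ := exists_diffeomorph_add_of_lipschitzWith (hsm.const_smul ε) hlt hL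
  exact ⟨Θ, fun z => by rw [h1, mul_smul], h2, h3⟩

/-- A map between open subsets of `E` is a `C^∞` diffeomorphism. -/
def OpenPartialHomeomorph.IsDiffeo (Φ : OpenPartialHomeomorph E E) : Prop :=
  ContDiffOn ℝ ∞ Φ Φ.source ∧ ContDiffOn ℝ ∞ Φ.symm Φ.target

namespace OpenPartialHomeomorph.IsDiffeo

variable {Φ Ψ : OpenPartialHomeomorph E E}

theorem symm (h : Φ.IsDiffeo) : Φ.symm.IsDiffeo := ⟨h.2, h.1⟩

theorem trans (h : Φ.IsDiffeo) (h' : Ψ.IsDiffeo) : (Φ.trans Ψ).IsDiffeo := by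
  constructor
  · rw [coe_trans, trans_source]
    exact h'.1.comp (h.1.mono inter_subset_left) fun x hx => hx.2
  · rw [coe_trans_symm, trans_target]
    exact h.2.comp (h'.2.mono inter_subset_left) fun x hx => hx.2

theorem refl : (OpenPartialHomeomorph.refl E).IsDiffeo :=
  ⟨contDiffOn_id, contDiffOn_id⟩

theorem of_homeomorph {Θ : E ≃ₜ E} (h : ContDiff ℝ ∞ Θ) (h' : ContDiff ℝ ∞ Θ.symm) :
    Θ.toOpenPartialHomeomorph.IsDiffeo :=
  ⟨h.contDiffOn, h'.contDiffOn⟩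

theorem addRight (a : E) : (Homeomorph.addRight a).toOpenPartialHomeomorph.IsDiffeo := by
  refine of_homeomorph ?_ ?_
  · exact (contDiff_id.add contDiff_const : ContDiff ℝ ∞ fun x : E => x + a)
  · exact (contDiff_id.add contDiff_const : ContDiff ℝ ∞ fun x : E => x + -a)

end OpenPartialHomeomorph.IsDiffeo

end Diffeomorphisms

/-! ### The open half-space as a copy of `ℝᵈ` -/

section HalfSpace

variable {d : ℕ} [NeZero d]

/-- The diffeomorphism of `ℝᵈ` onto the open half-space that applies `exp` to the first
coordinate. -/
noncomputable def expFirst (d : ℕ) [NeZero d] : OpenPartialHomeomorph (Euc d) (Euc d) where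
  toFun y := WithLp.toLp 2 (Function.update y 0 (Real.exp (y 0)))
  invFun y := WithLp.toLp 2 (Function.update y 0 (Real.log (y 0)))
  source := univ
  target := {y | 0 < y 0}
  map_source' y _ := by simp [Real.exp_pos]
  map_target' _ _ := mem_univ _
  left_inv' y _ := by
    ext i
    by_cases hi : i = 0
    · subst hi; simp
    · simp [hi]
  right_inv' y hy := by
    ext i
    by_cases hi : i = 0
    · subst hi; simpa using Real.exp_log hy
    · simp [hi]
  open_source := isOpen_univ
  open_target := isOpen_lt continuous_const (by fun_prop)
  continuousOn_toFun := by
    refine Continuous.continuousOn ?_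
    exact (PiLp.continuous_toLp 2 _).comp ((PiLp.continuous_ofLp 2 _).update 0 (by fun_prop))
  continuousOn_invFun := by
    refine (PiLp.continuous_toLp 2 _).comp_continuousOn ?_
    refine continuousOn_pi.2 fun i => ?_
    by_cases hi : i = 0
    · subst hi
      simp only [Function.update_self]
      exact ContinuousOn.log (by fun_prop) fun y hy => ne_of_gt hy
    · simp only [Function.update_of_ne hi]
      fun_prop

theorem expFirst_pos (y : Euc d) : 0 < expFirst d y 0 := by
  simp [expFirst, Real.exp_pos]

theorem isDiffeo_expFirst : (expFirst d).IsDiffeo := by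
  constructor
  · refine contDiffOn_euclidean.2 fun i => ?_
    by_cases hi : i = 0
    · subst hi
      have h : ContDiff ℝ ∞ fun y : Euc d => Real.exp (y 0) := by fun_prop
      refine h.contDiffOn.congr fun y _ => ?_
      simp [expFirst]
    · have h : ContDiff ℝ ∞ fun y : Euc d => y i := by fun_prop
      refine h.contDiffOn.congr fun y _ => ?_
      simp [expFirst, hi]
  · refine contDiffOn_euclidean.2 fun i => ?_
    by_cases hi : i = 0
    · subst hi
      have h : ContDiffOn ℝ ∞ (fun y : Euc d => Real.log (y 0)) {y | 0 < y 0} :=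
        ContDiffOn.log (by fun_prop) fun y hy => ne_of_gt hy
      refine h.congr fun y _ => ?_
      simp [expFirst]
    · have h : ContDiff ℝ ∞ fun y : Euc d => y i := by fun_prop
      refine h.contDiffOn.congr fun y _ => ?_
      simp [expFirst, hi]

/-- `expFirst`, seen as a map to the closed half-space. -/
noncomputable def expFirstHalfSpace (d : ℕ) [NeZero d] :
    OpenPartialHomeomorph (Euc d) (EuclideanHalfSpace d) where
  toFun y := ⟨expFirst d y, (expFirst_pos y).le⟩
  invFun y := (expFirst d).symm y.1
  source := univ
  target := {y | 0 < y.1 0}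
  map_source' y _ := expFirst_pos y
  map_target' _ _ := mem_univ _
  left_inv' y _ := (expFirst d).left_inv (mem_univ y)
  right_inv' y hy := Subtype.ext ((expFirst d).right_inv hy)
  open_source := isOpen_univ
  open_target := isOpen_lt continuous_const (by fun_prop)
  continuousOn_toFun := Continuous.continuousOn
    ((continuousOn_univ.1 (expFirst d).continuousOn).subtype_mk fun y => (expFirst_pos y).le)
  continuousOn_invFun :=
    (expFirst d).continuousOn_symm.comp continuous_subtype_val.continuousOn fun y hy => hy

end HalfSpace

/-! ### Locality and translation of border points -/

section BorderPoints

theorem image_inter_ball_eq_iff {d : ℕ} (R : Euc d ≃ᵃⁱ[ℝ] Euc d) (S T : Set (Euc d))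
    (x : Euc d) (r : ℝ) :
    (R '' S) ∩ Metric.ball (R x) r = T ∩ Metric.ball (R x) r ↔
      ∀ z ∈ Metric.ball x r, (z ∈ S ↔ R z ∈ T) := by
  have key : ∀ z, R z ∈ Metric.ball (R x) r ↔ z ∈ Metric.ball x r := fun z => by
    simp [Metric.mem_ball]
  constructor
  · intro h z hz
    have h1 := Set.ext_iff.1 h (R z)
    simp only [mem_inter_iff, (key z).2 hz, and_true, R.injective.mem_set_image] at h1
    exact h1
  · intro h
    ext w
    obtain ⟨z, rfl⟩ := R.surjective w
    simp only [mem_inter_iff, key, R.injective.mem_set_image]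
    exact and_congr_left fun hz => h z hz

variable {d : ℕ} [NeZero d]

/-- A pointwise reformulation of `IsC0BorderPoint`. -/
theorem isC0BorderPoint_iff {A : Set (Euc d)} {x : Euc d} :
    IsC0BorderPoint A x ↔ x ∈ frontier (interior A) ∧
      ∃ R : Euc d ≃ᵃⁱ[ℝ] Euc d, ∃ r > 0, ∃ γ : Euc (d - 1) → ℝ, Continuous γ ∧
        ∀ z ∈ Metric.ball x r, (z ∈ A ↔ z ∈ closure (interior A)) ∧
          (z ∈ A ↔ R z ∈ closedEpi γ) ∧ (z ∈ interior A ↔ R z ∈ strictEpi γ) := by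
  constructor
  · rintro ⟨⟨hx, R, δ, hδ, γ, hγ, h1, h2⟩, δ', hδ', h3⟩
    rw [image_inter_ball_eq_iff] at h1 h2
    refine ⟨hx, R, min δ δ', lt_min hδ hδ', γ, hγ, fun z hz => ?_⟩
    have hz1 : z ∈ Metric.ball x δ := Metric.ball_subset_ball (min_le_left _ _) hz
    have hz2 : z ∈ Metric.ball x δ' := Metric.ball_subset_ball (min_le_right _ _) hz
    have h4 : z ∈ A ↔ z ∈ closure (interior A) := by
      have := Set.ext_iff.1 h3 z
      simpa only [mem_inter_iff, hz2, and_true] using this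
    exact ⟨h4, h4.trans (h1 z hz1), h2 z hz1⟩
  · rintro ⟨hx, R, r, hr, γ, hγ, h⟩
    refine ⟨⟨hx, R, r, hr, γ, hγ, ?_, ?_⟩, r, hr, ?_⟩
    · rw [image_inter_ball_eq_iff]
      exact fun z hz => (h z hz).1.symm.trans (h z hz).2.1
    · rw [image_inter_ball_eq_iff]
      exact fun z hz => (h z hz).2.2
    · ext z
      exact and_congr_left fun hz => (h z hz).1

/-- Interior and closure are local, so all conditions can be read in a smaller ball. This allows the
domain of a border chart to shrink. -/
theorem IsC0BorderPoint.congr {A B O : Set (Euc d)} {x : Euc d} (h : IsC0BorderPoint A x)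
    (hO : IsOpen O) (hx : x ∈ O) (hAB : A ∩ O = B ∩ O) : IsC0BorderPoint B x := by
  rw [isC0BorderPoint_iff] at h ⊢
  obtain ⟨hfr, R, r, hr, γ, hγ, h⟩ := h
  have hint : interior A ∩ O = interior B ∩ O := by
    have := congrArg interior hAB
    rwa [interior_inter, interior_inter, hO.interior_eq] at this
  have hcl : ∀ {S T : Set (Euc d)}, S ∩ O = T ∩ O → ∀ z ∈ O, z ∈ closure S → z ∈ closure T := by
    intro S T hST z hz hzS
    have h1 : z ∈ closure (S ∩ O) := by
      rw [inter_comm]; exact hO.inter_closure ⟨hz, hzS⟩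
    rw [hST] at h1
    exact closure_mono inter_subset_left h1
  have hcl' : ∀ z ∈ O, (z ∈ closure (interior A) ↔ z ∈ closure (interior B)) := fun z hz =>
    ⟨hcl hint z hz, hcl hint.symm z hz⟩
  have hint' : ∀ z ∈ O, (z ∈ interior A ↔ z ∈ interior B) := fun z hz => by
    have := Set.ext_iff.1 hint z
    simpa only [mem_inter_iff, hz, and_true] using this
  have hAB' : ∀ z ∈ O, (z ∈ A ↔ z ∈ B) := fun z hz => by
    have := Set.ext_iff.1 hAB z
    simpa only [mem_inter_iff, hz, and_true] using this
  obtain ⟨r', hr', hball⟩ := Metric.isOpen_iff.1 hO x hx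
  refine ⟨?_, R, min r r', lt_min hr hr', γ, hγ, fun z hz => ?_⟩
  · rw [isOpen_interior.frontier_eq] at hfr ⊢
    exact ⟨(hcl' x hx).1 hfr.1, fun hh => hfr.2 ((hint' x hx).2 hh)⟩
  · have hz1 : z ∈ Metric.ball x r := Metric.ball_subset_ball (min_le_left _ _) hz
    have hz2 : z ∈ O := hball (Metric.ball_subset_ball (min_le_right _ _) hz)
    rw [← hAB' z hz2, ← hcl' z hz2, ← hint' z hz2]
    exact h z hz1

/-- The translation is absorbed into the rigid motion. It is used to centre charts. -/
theorem IsC0BorderPoint.translate {A : Set (Euc d)} {x : Euc d} (h : IsC0BorderPoint A x)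
    (a : Euc d) : IsC0BorderPoint ((fun z => z + a) '' A) (x + a) := by
  rw [isC0BorderPoint_iff] at h ⊢
  obtain ⟨hfr, R, r, hr, γ, hγ, h⟩ := h
  have hint : interior ((fun z => z + a) '' A) = (fun z => z + a) '' interior A :=
    ((Homeomorph.addRight a).image_interior A).symm
  have hcl : closure ((fun z => z + a) '' interior A) = (fun z => z + a) '' closure (interior A) :=
    ((Homeomorph.addRight a).image_closure _).symm
  have hfr' : frontier ((fun z => z + a) '' interior A) =
      (fun z => z + a) '' frontier (interior A) :=
    ((Homeomorph.addRight a).image_frontier _).symm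
  have hmem : ∀ (S : Set (Euc d)) z, z ∈ (fun z => z + a) '' S ↔ z - a ∈ S := fun S z => by
    simp [sub_eq_add_neg]
  refine ⟨?_, (AffineIsometryEquiv.constVAdd ℝ (Euc d) (-a)).trans R, r, hr, γ, hγ,
    fun z hz => ?_⟩
  · rw [hint, hfr']
    exact mem_image_of_mem _ hfr
  · have hz' : z - a ∈ Metric.ball x r := by
      rw [Metric.mem_ball, dist_eq_norm] at hz ⊢
      convert hz using 2
      abel
    have hR : ((AffineIsometryEquiv.constVAdd ℝ (Euc d) (-a)).trans R) z = R (z - a) := by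
      simp [sub_eq_neg_add]
    rw [hint, hcl, hmem, hmem, hmem, hR]
    exact h _ hz'

end BorderPoints

/-! ### Charts, restriction and compatibility -/

namespace EucChart

variable {d : ℕ} {M : Type*} [TopologicalSpace M]

theorem continuousOn (c : EucChart d M) : ContinuousOn c.toFun c.source :=
  continuousOn_iff_continuous_domRestrict.2 c.isEmbedding_restrict.continuous

theorem injOn (c : EucChart d M) : InjOn c.toFun c.source :=
  injOn_iff_injective.2 c.isEmbedding_restrict.injective

theorem continuousAt (c : EucChart d M) {x : M} (hx : x ∈ c.source) : ContinuousAt c.toFun x :=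
  c.continuousOn.continuousAt (c.open_source.mem_nhds hx)

/-- Substitute for openness of the chart map, which may fail at border points: open sets of the
domain are traces of open sets of `ℝᵈ`. -/
theorem exists_isOpen_mem_iff (c : EucChart d M) {W : Set M} (hW : IsOpen W) :
    ∃ G, IsOpen G ∧ ∀ y ∈ c.source, (c.toFun y ∈ G ↔ y ∈ W) := by
  obtain ⟨G, hG, h⟩ := c.isEmbedding_restrict.isInducing.isOpen_iff.1
    (hW.preimage continuous_subtype_val : IsOpen (Subtype.val ⁻¹' W : Set c.source))
  exact ⟨G, hG, fun y hy => Set.ext_iff.1 h ⟨y, hy⟩⟩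

theorem continuousOn_of_comp (c : EucChart d M) {X : Type*} [TopologicalSpace X] {f : X → M}
    {s : Set X} (hs : MapsTo f s c.source) (h : ContinuousOn (c.toFun ∘ f) s) :
    ContinuousOn f s := by
  rw [continuousOn_iff_continuous_domRestrict] at h ⊢
  have : Continuous (hs.restrict f s c.source) :=
    c.isEmbedding_restrict.isInducing.continuous_iff.2 h
  exact continuous_subtype_val.comp this

theorem IsInteriorChart.isOpen_image {c : EucChart d M} (hc : c.IsInteriorChart) {W : Set M}
    (hW : IsOpen W) (hWc : W ⊆ c.source) : IsOpen (c.toFun '' W) := by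
  obtain ⟨G, hG, h⟩ := c.exists_isOpen_mem_iff hW
  have : c.toFun '' W = c.toFun '' c.source ∩ G := by
    ext z
    constructor
    · rintro ⟨y, hy, rfl⟩
      exact ⟨⟨y, hWc hy, rfl⟩, (h y (hWc hy)).2 hy⟩
    · rintro ⟨⟨y, hy, rfl⟩, hz⟩
      exact ⟨y, (h y hy).1 hz, rfl⟩
  rw [this]
  exact IsOpen.inter hc hG

/-- The composition of the restriction of a chart to a smaller open set with a homeomorphism
between open subsets of `ℝᵈ`. -/
def restrComp (c : EucChart d M) (V : Set M) (hV : IsOpen V) (hVc : V ⊆ c.source)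
    (Ψ : OpenPartialHomeomorph (Euc d) (Euc d)) (hΨ : MapsTo c.toFun V Ψ.source) :
    EucChart d M where
  source := V
  toFun := Ψ ∘ c.toFun
  open_source := hV
  isEmbedding_restrict := by
    have h1 : IsEmbedding (V.domRestrict c.toFun) :=
      c.isEmbedding_restrict.comp (IsEmbedding.inclusion hVc)
    exact Ψ.isOpenEmbedding_restrict.isEmbedding.comp
      (h1.codRestrict Ψ.source fun x => hΨ x.2)

theorem SmoothlyCompatible.symm {c c' : EucChart d M} (h : c.SmoothlyCompatible c') :
    c'.SmoothlyCompatible c := by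
  obtain ⟨Φ, h1, h2, h3, h4⟩ := h
  refine ⟨Φ.symm, h2, h1, ?_, ?_⟩
  · rintro _ ⟨x, ⟨hx', hx⟩, rfl⟩
    rw [← h4 x ⟨hx, hx'⟩]
    exact Φ.map_source (h3 ⟨x, ⟨hx, hx'⟩, rfl⟩)
  · rintro x ⟨hx', hx⟩
    rw [← h4 x ⟨hx, hx'⟩]
    exact Φ.left_inv (h3 ⟨x, ⟨hx, hx'⟩, rfl⟩)

theorem SmoothlyCompatible.refl (c : EucChart d M) : c.SmoothlyCompatible c :=
  ⟨OpenPartialHomeomorph.refl _, contDiffOn_id, contDiffOn_id, subset_univ _, fun _ _ => rfl⟩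

theorem SmoothlyCompatible.restrComp {c c' : EucChart d M} (h : c.SmoothlyCompatible c')
    {V : Set M} (hV : IsOpen V) (hVc : V ⊆ c.source)
    {Ψ : OpenPartialHomeomorph (Euc d) (Euc d)} (hΨ : MapsTo c.toFun V Ψ.source)
    (hΨd : Ψ.IsDiffeo) : (c.restrComp V hV hVc Ψ hΨ).SmoothlyCompatible c' := by
  obtain ⟨Φ, h1, h2, h3, h4⟩ := h
  obtain ⟨h5, h6⟩ := hΨd.symm.trans (Ψ := Φ) ⟨h1, h2⟩
  refine ⟨Ψ.symm.trans Φ, h5, h6, ?_, ?_⟩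
  · rintro _ ⟨x, ⟨hx, hx'⟩, rfl⟩
    have h7 : Ψ.symm (Ψ (c.toFun x)) = c.toFun x := Ψ.left_inv (hΨ hx)
    rw [OpenPartialHomeomorph.trans_source]
    refine ⟨Ψ.map_source (hΨ hx), ?_⟩
    change Ψ.symm (Ψ (c.toFun x)) ∈ Φ.source
    rw [h7]
    exact h3 ⟨x, ⟨hVc hx, hx'⟩, rfl⟩
  · rintro x ⟨hx, hx'⟩
    have h7 : Ψ.symm (Ψ (c.toFun x)) = c.toFun x := Ψ.left_inv (hΨ hx)
    change Φ (Ψ.symm (Ψ (c.toFun x))) = _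
    rw [h7]
    exact h4 x ⟨hVc hx, hx'⟩

end EucChart

/-! ### The maximal atlas, the interior and local diffeomorphisms -/

namespace SmoothKinkStructure

variable {d : ℕ} [NeZero d] {M : Type*} [TopologicalSpace M] (K : SmoothKinkStructure d M)

/-- Adjoining `e` gives another atlas, so maximality forces `e` to be there already. -/
theorem mem_charts {e : EucChart d M} (he : e.IsInteriorChart ∨ ∃ x, e.IsBorderChartAt x)
    (h : ∀ c ∈ K.charts, e.SmoothlyCompatible c) : e ∈ K.charts := by
  have hA : IsSmoothKinkAtlas (insert e K.charts) := by
    refine ⟨?_, ?_, fun x => ?_⟩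
    · rintro c (rfl | hc)
      · exact he
      · exact K.maximal.prop.interior_or_border c hc
    · rintro c (rfl | hc) c' (rfl | hc')
      · exact .refl _
      · exact h c' hc'
      · exact (h c hc).symm
      · exact K.maximal.prop.compatible c hc c' hc'
    · obtain ⟨c, hc, h⟩ := K.maximal.prop.covers x
      exact ⟨c, mem_insert_of_mem _ hc, h⟩
  exact K.maximal.le_of_ge hA (subset_insert e K.charts) (mem_insert e _)

theorem exists_chart (x : M) : ∃ c ∈ K.charts, x ∈ c.source := by
  obtain ⟨c, hc, h⟩ := K.maximal.prop.covers x
  exact ⟨c, hc, h.elim (fun h => h.1) fun h => h.1⟩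

theorem exists_transition {c c' : EucChart d M} (hc : c ∈ K.charts) (hc' : c' ∈ K.charts) :
    ∃ Φ : OpenPartialHomeomorph (Euc d) (Euc d), Φ.IsDiffeo ∧
      ∀ x ∈ c.source, x ∈ c'.source → c.toFun x ∈ Φ.source ∧ Φ (c.toFun x) = c'.toFun x := by
  obtain ⟨Φ, h1, h2, h3, h4⟩ := K.maximal.prop.compatible c hc c' hc'
  exact ⟨Φ, ⟨h1, h2⟩, fun x hx hx' => ⟨h3 ⟨x, ⟨hx, hx'⟩, rfl⟩, h4 x ⟨hx, hx'⟩⟩⟩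

/-- The interior of a manifold with kinks: the points that have an interior chart. -/
def interior : Set M := {x | ∃ c ∈ K.charts, x ∈ c.source ∧ c.IsInteriorChart}

theorem isOpen_interior : IsOpen K.interior := by
  refine isOpen_iff_forall_mem_open.2 ?_
  rintro x ⟨c, hc, hx, hci⟩
  exact ⟨c.source, fun y hy => ⟨c, hc, hy, hci⟩, c.open_source, hx⟩

theorem mem_interior {c : EucChart d M} (hc : c ∈ K.charts) {x : M} (hx : x ∈ c.source)
    (h : c.toFun '' c.source ∈ 𝓝 (c.toFun x)) : x ∈ K.interior := by
  obtain ⟨O, hO, hOo, hxO⟩ := mem_nhds_iff.1 h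
  have hV : IsOpen (c.source ∩ c.toFun ⁻¹' O) :=
    c.continuousOn.isOpen_inter_preimage c.open_source hOo
  let e := c.restrComp _ hV inter_subset_left (OpenPartialHomeomorph.refl _) (mapsTo_univ _ _)
  have he : e.IsInteriorChart := by
    have : e.toFun '' e.source = O := by
      change (id ∘ c.toFun) '' (c.source ∩ c.toFun ⁻¹' O) = O
      rw [Function.id_comp, image_inter_preimage]
      exact inter_eq_right.2 hO
    rw [EucChart.IsInteriorChart, this]
    exact hOo
  refine ⟨e, K.mem_charts (Or.inl he) fun c' hc' => ?_, ⟨hx, hxO⟩, he⟩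
  exact (K.maximal.prop.compatible c hc c' hc').restrComp hV _ _ .refl

/-- In charts around `x` and `f x`, the map `f` is near `x` the restriction of a diffeomorphism
between open subsets of `ℝᵈ`. -/
def IsLocalDiffeoAt (f : M → M) (x : M) : Prop :=
  ∃ c ∈ K.charts, ∃ c' ∈ K.charts, x ∈ c.source ∧ f x ∈ c'.source ∧
    ∃ Ψ : OpenPartialHomeomorph (Euc d) (Euc d), Ψ.IsDiffeo ∧ c.toFun x ∈ Ψ.source ∧
      ∀ᶠ y in 𝓝 x, c'.toFun (f y) = Ψ (c.toFun y)

namespace IsLocalDiffeoAt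

variable {K} {f g : M → M} {x : M}

theorem id : K.IsLocalDiffeoAt id x := by
  obtain ⟨c, hc, hx⟩ := K.exists_chart x
  exact ⟨c, hc, c, hc, hx, hx, _, .refl, mem_univ _, Filter.Eventually.of_forall fun _ => rfl⟩

theorem congr (h : K.IsLocalDiffeoAt f x) (hfg : f =ᶠ[𝓝 x] g) : K.IsLocalDiffeoAt g x := by
  obtain ⟨c, hc, c', hc', hx, hx', Ψ, hΨ, hxΨ, he⟩ := h
  refine ⟨c, hc, c', hc', hx, hfg.eq_of_nhds ▸ hx', Ψ, hΨ, hxΨ, ?_⟩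
  filter_upwards [he, hfg] with y hy hy'
  rw [← hy', hy]

/-- Transition maps are restrictions of diffeomorphisms between open sets, so they can be composed
with `Ψ` on both sides. Continuity of `f` keeps `f y` in the overlap of the target charts. -/
theorem exists_of_mem (h : K.IsLocalDiffeoAt f x) (hf : ContinuousAt f x) {c c' : EucChart d M}
    (hc : c ∈ K.charts) (hc' : c' ∈ K.charts) (hx : x ∈ c.source) (hx' : f x ∈ c'.source) :
    ∃ Ψ : OpenPartialHomeomorph (Euc d) (Euc d), Ψ.IsDiffeo ∧ c.toFun x ∈ Ψ.source ∧
      ∀ᶠ y in 𝓝 x, c'.toFun (f y) = Ψ (c.toFun y) := by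
  obtain ⟨c₁, hc₁, c₁', hc₁', hx₁, hx₁', Ψ, hΨ, hxΨ, he⟩ := h
  obtain ⟨Φ₁, hΦ₁, h₁⟩ := K.exists_transition hc hc₁
  obtain ⟨Φ₂, hΦ₂, h₂⟩ := K.exists_transition hc₁' hc'
  refine ⟨Φ₁.trans (Ψ.trans Φ₂), hΦ₁.trans (hΨ.trans hΦ₂), ?_, ?_⟩
  · simp only [OpenPartialHomeomorph.trans_source, mem_inter_iff, mem_preimage]
    refine ⟨(h₁ x hx hx₁).1, ?_⟩
    rw [(h₁ x hx hx₁).2]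
    refine ⟨hxΨ, ?_⟩
    rw [← he.self_of_nhds]
    exact (h₂ _ hx₁' hx').1
  · filter_upwards [he, c.open_source.mem_nhds hx, c₁.open_source.mem_nhds hx₁,
      hf (c'.open_source.mem_nhds hx'), hf (c₁'.open_source.mem_nhds hx₁')] with y hy h3 h4 h5 h6
    simp only [OpenPartialHomeomorph.coe_trans, Function.comp_apply]
    rw [(h₁ y h3 h4).2, ← hy, (h₂ _ h6 h5).2]

theorem comp (hg : K.IsLocalDiffeoAt g (f x)) (hf : K.IsLocalDiffeoAt f x)
    (hgc : ContinuousAt g (f x)) (hfc : ContinuousAt f x) : K.IsLocalDiffeoAt (g ∘ f) x := by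
  obtain ⟨c, hc, hx⟩ := K.exists_chart x
  obtain ⟨c', hc', hx'⟩ := K.exists_chart (f x)
  obtain ⟨c'', hc'', hx''⟩ := K.exists_chart (g (f x))
  obtain ⟨Ψ, hΨ, h1, h2⟩ := hf.exists_of_mem hfc hc hc' hx hx'
  obtain ⟨Φ, hΦ, h3, h4⟩ := hg.exists_of_mem hgc hc' hc'' hx' hx''
  refine ⟨c, hc, c'', hc'', hx, hx'', Ψ.trans Φ, hΨ.trans hΦ, ?_, ?_⟩
  · rw [OpenPartialHomeomorph.trans_source]
    refine ⟨h1, ?_⟩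
    rw [mem_preimage, ← h2.self_of_nhds]
    exact h3
  · filter_upwards [h2, hfc.eventually h4] with y hy hy'
    rw [Function.comp_apply, hy', hy, OpenPartialHomeomorph.coe_trans, Function.comp_apply]

/-- Since `Ψ` is open, it carries the open image of a neighbourhood of `x` to an open set, which
lies in the image of the chart around `f x`. -/
theorem mem_interior (h : K.IsLocalDiffeoAt f x) (hf : ContinuousAt f x) (hx : x ∈ K.interior) :
    f x ∈ K.interior := by
  obtain ⟨c, hc, hxc, hci⟩ := hx
  obtain ⟨c', hc', hx'⟩ := K.exists_chart (f x)
  obtain ⟨Ψ, hΨ, h1, h2⟩ := h.exists_of_mem hf hc hc' hxc hx'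
  have h3 : ∀ᶠ y in 𝓝 x, c'.toFun (f y) = Ψ (c.toFun y) ∧ y ∈ c.source ∧ f y ∈ c'.source ∧
      c.toFun y ∈ Ψ.source := by
    filter_upwards [h2, c.open_source.mem_nhds hxc, hf (c'.open_source.mem_nhds hx'),
      c.continuousAt hxc (Ψ.open_source.mem_nhds h1)] with y h3 h4 h5 h6
    exact ⟨h3, h4, h5, h6⟩
  obtain ⟨U, hU, hUo, hxU⟩ := mem_nhds_iff.1 h3
  have ho : IsOpen (Ψ '' (c.toFun '' U)) := by
    refine Ψ.isOpen_image_of_subset_source (hci.isOpen_image hUo fun y hy => (hU hy).2.1) ?_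
    rintro _ ⟨y, hy, rfl⟩
    exact (hU hy).2.2.2
  refine K.mem_interior hc' hx' (Filter.mem_of_superset (ho.mem_nhds ?_) ?_)
  · rw [(hU hxU).1]
    exact mem_image_of_mem _ (mem_image_of_mem _ hxU)
  · rintro _ ⟨_, ⟨y, hy, rfl⟩, rfl⟩
    exact ⟨f y, (hU hy).2.2.1, (hU hy).1⟩

end IsLocalDiffeoAt

end SmoothKinkStructure

/-! ### Local pushes into the interior -/

theorem EucChart.isCompact_inter_preimage {d : ℕ} {M : Type*} [TopologicalSpace M]
    (c : EucChart d M) {T : Set (Euc d)} (hT : IsCompact (c.toFun '' c.source ∩ T)) :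
    IsCompact (c.source ∩ c.toFun ⁻¹' T) := by
  have h1 : c.toFun '' c.source ∩ T ⊆ range (c.source.domRestrict c.toFun) := by
    rw [range_domRestrict]; exact inter_subset_left
  have h2 := (c.isEmbedding_restrict.isInducing.isCompact_preimage_iff h1).2 hT
  convert h2.image continuous_subtype_val using 1
  ext y
  constructor
  · rintro ⟨hy, hyT⟩
    exact ⟨⟨y, hy⟩, ⟨⟨y, hy, rfl⟩, hyT⟩, rfl⟩
  · rintro ⟨⟨y, hy⟩, ⟨-, hyT⟩, rfl⟩
    exact ⟨hy, hyT⟩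

/-- Near a `C⁰` border point of `A`, the vertical translations move `A` into its interior. -/
theorem IsC0BorderPoint.exists_direction {d : ℕ} [NeZero d] {A : Set (Euc d)} {x : Euc d}
    (h : IsC0BorderPoint A x) : ∃ r > 0, ∃ v : Euc d, IsCompact (A ∩ Metric.closedBall x r) ∧
      ∀ z ∈ A, z ∈ Metric.ball x r → ∀ t : ℝ, 0 < t → z + t • v ∈ Metric.ball x r →
        z + t • v ∈ interior A := by
  rw [isC0BorderPoint_iff] at h
  obtain ⟨-, R, r, hr, γ, -, h⟩ := h
  have hball : Metric.closedBall x (r / 2) ⊆ Metric.ball x r :=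
    Metric.closedBall_subset_ball (by linarith)
  let l : Fin d := ⟨d - 1, Nat.sub_lt (NeZero.pos d) one_pos⟩
  -- The direction is the last basis vector, pulled back by `R`. The radius is halved so that the
  -- epigraph description holds on the closed ball as well.
  refine ⟨r / 2, by positivity, R.linearIsometryEquiv.symm (EuclideanSpace.single l 1), ?_, ?_⟩
  · have : A ∩ Metric.closedBall x (r / 2) =
        Metric.closedBall x (r / 2) ∩ closure (interior A) := by
      ext z
      rw [inter_comm]
      exact and_congr_right fun hz => (h z (hball hz)).1
    rw [this]
    exact (isCompact_closedBall x _).inter_right isClosed_closure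
  · intro z hzA hz t ht hz'
    have hz1 := hball (Metric.ball_subset_closedBall hz)
    have hz2 := hball (Metric.ball_subset_closedBall hz')
    have hR : R (z + t • R.linearIsometryEquiv.symm (EuclideanSpace.single l 1)) =
        R z + t • EuclideanSpace.single l 1 := by
      have := R.map_vadd z (t • R.linearIsometryEquiv.symm (EuclideanSpace.single l 1))
      rw [vadd_eq_add, vadd_eq_add, add_comm] at this
      rw [this, map_smul, LinearIsometryEquiv.apply_symm_apply, add_comm]
    have h1 : γ (R z).front ≤ (R z).last := (h z hz1).2.1.1 hzA
    rw [(h _ hz2).2.2, hR]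
    have hfront : (R z + t • EuclideanSpace.single l (1 : ℝ)).front = (R z).front := by
      ext i
      have : (⟨i.1, by omega⟩ : Fin d) ≠ l := fun hh => by
        have h2 := congrArg Fin.val hh
        have h3 := i.2
        simp only [l] at h2
        omega
      simp [Euc.front, this]
    have hlast : (R z + t • EuclideanSpace.single l (1 : ℝ)).last = (R z).last + t := by
      simp [Euc.last, l]
    change γ _ < _
    rw [hfront, hlast]
    linarith

namespace SmoothKinkStructure

variable {d : ℕ} [NeZero d] {M : Type*} [TopologicalSpace M] (K : SmoothKinkStructure d M)

theorem exists_chart_direction (x : M) : ∃ c ∈ K.charts, x ∈ c.source ∧ ∃ r > 0, ∃ v : Euc d,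
    IsCompact (c.toFun '' c.source ∩ Metric.closedBall (c.toFun x) r) ∧
      ∀ z ∈ c.toFun '' c.source, z ∈ Metric.ball (c.toFun x) r → ∀ t : ℝ, 0 < t →
        z + t • v ∈ Metric.ball (c.toFun x) r →
        z + t • v ∈ _root_.interior (c.toFun '' c.source) := by
  obtain ⟨c, hc, ⟨hx, hci⟩ | ⟨hx, -, hb⟩⟩ := K.maximal.prop.covers x
  · obtain ⟨r, hr, h⟩ := Metric.nhds_basis_closedBall.mem_iff.1
      (hci.mem_nhds (mem_image_of_mem c.toFun hx))
    -- Around an interior point no push is needed, so the zero vector serves as direction.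
    refine ⟨c, hc, hx, r, hr, 0, ?_, fun z hz _ t _ _ => ?_⟩
    · rw [inter_eq_right.2 h]
      exact isCompact_closedBall _ _
    · rw [smul_zero, add_zero, hci.interior_eq]
      exact hz
  · exact ⟨c, hc, hx, hb.exists_direction⟩

/-- `f` is a smooth embedding of `M` in itself that moves the points of `s` to the interior and
fixes the points outside `W`. -/
structure IsPush (s W : Set M) (f : M → M) : Prop where
  continuous : Continuous f
  injective : Function.Injective f
  isLocalDiffeoAt : ∀ y, K.IsLocalDiffeoAt f y
  eq_self : ∀ y ∉ W, f y = y
  eq_self_or_mem_interior : ∀ y, f y = y ∨ f y ∈ K.interior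
  mem_interior : ∀ y ∈ s, f y ∈ K.interior

/-- In the chart the push is `z ↦ z + ε ρ(z) v`; elsewhere it is the identity. The bound on the
functions in `H` is what later keeps orbits of the infinite composition inside the sets of the
cover. -/
theorem exists_push [T2Space M] (x : M) : ∃ U, IsOpen U ∧ x ∈ U ∧ (∃ C, IsCompact C ∧ U ⊆ C) ∧
    (∃ c ∈ K.charts, U ⊆ c.source) ∧ ∀ s W : Set M, IsCompact s → IsOpen W → s ⊆ W → W ⊆ U →
      ∀ H : Set (M → ℝ), H.Finite → (∀ h ∈ H, Continuous h) → ∀ η > 0,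
        ∃ f : M → M, K.IsPush s W f ∧ ∀ h ∈ H, ∀ y, h (f y) ≤ h y + η := by
  classical
  obtain ⟨c, hc, hx, r, hr, v, hcpt, hv⟩ := K.exists_chart_direction x
  set A := c.toFun '' c.source with hA
  set B := Metric.ball (c.toFun x) r with hB
  refine ⟨c.source ∩ c.toFun ⁻¹' B, c.continuousOn.isOpen_inter_preimage c.open_source
    Metric.isOpen_ball, ⟨hx, Metric.mem_ball_self hr⟩, ⟨_, c.isCompact_inter_preimage hcpt,
    inter_subset_inter_right _ (preimage_mono Metric.ball_subset_closedBall)⟩,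
    ⟨c, hc, inter_subset_left⟩, ?_⟩
  intro s W hs hW hsW hWU H hH hHc η hη
  have hWc : W ⊆ c.source := fun y hy => (hWU hy).1
  obtain ⟨G, hG, hGW⟩ := c.exists_isOpen_mem_iff hW
  have hWG : ∀ y ∈ W, c.toFun y ∈ G ∩ B := fun y hy => ⟨(hGW y (hWc hy)).2 hy, (hWU hy).2⟩
  obtain ⟨ρ, hρc, hρK, hρG, hρs, hρr, ε₀, hε₀, hΘ⟩ := exists_push_diffeomorph
    (hs.image_of_continuousOn (c.continuousOn.mono (hsW.trans hWc)))
    (hG.inter Metric.isOpen_ball) (t := G ∩ B) (by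
      rintro _ ⟨y, hy, rfl⟩
      exact hWG y (hsW hy)) v
  have hZ : IsCompact (A ∩ tsupport ρ) := by
    have : A ∩ tsupport ρ = (A ∩ Metric.closedBall (c.toFun x) r) ∩ tsupport ρ := by
      rw [inter_assoc, inter_eq_right.2 (fun z hz => Metric.ball_subset_closedBall (hρG hz).2)]
    rw [this]
    exact hcpt.inter_right (isClosed_tsupport ρ)
  have : Nonempty M := ⟨x⟩
  let inv := Function.invFunOn c.toFun c.source
  have hinv_mem : ∀ z ∈ A, inv z ∈ c.source := fun z hz => Function.invFunOn_mem hz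
  have hinv_eq : ∀ z ∈ A, c.toFun (inv z) = z := fun z hz => Function.invFunOn_eq hz
  have hinv : ∀ y ∈ c.source, inv (c.toFun y) = y := fun y hy => c.injOn.leftInvOn_invFunOn hy
  have hinv_cont : ContinuousOn inv A :=
    c.continuousOn_of_comp hinv_mem (continuousOn_id.congr fun z hz => hinv_eq z hz)
  -- Points move by at most `ε * ‖v‖`, and each `h ∘ inv` is uniformly continuous on the compact set
  -- `A ∩ tsupport ρ`.
  have hε : ∀ᶠ ε in 𝓝[>] (0 : ℝ), ∀ h ∈ H, ∀ z ∈ A ∩ tsupport ρ, ∀ z' ∈ A ∩ tsupport ρ,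
      dist z' z ≤ ε * ‖v‖ → h (inv z') ≤ h (inv z) + η := by
    refine (Filter.eventually_all_finite hH).2 fun h hh => ?_
    have hu := hZ.uniformContinuousOn_of_continuous
      ((hHc h hh).comp_continuousOn (hinv_cont.mono inter_subset_left))
    obtain ⟨δ, hδ, hu⟩ := Metric.uniformContinuousOn_iff.1 hu η hη
    have ht : Filter.Tendsto (fun ε : ℝ => ε * ‖v‖) (𝓝[>] 0) (𝓝 0) := by
      have : Continuous fun ε : ℝ => ε * ‖v‖ := by fun_prop
      simpa using (this.tendsto 0).mono_left nhdsWithin_le_nhds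
    filter_upwards [ht.eventually_lt_const hδ] with ε hε z hz z' hz' hd
    have := hu z' hz' z hz (hd.trans_lt hε)
    rw [Real.dist_eq] at this
    have := le_abs_self ((h ∘ inv) z' - (h ∘ inv) z)
    simp only [Function.comp_apply] at *
    linarith
  obtain ⟨ε, hεH, hε, hεε₀⟩ := (hε.and (Ioo_mem_nhdsGT hε₀)).exists
  obtain ⟨Θ, hΘeq, hΘ1, hΘ2⟩ := hΘ ε hε hεε₀
  have hfix : ∀ z ∉ tsupport ρ, Θ z = z := fun z hz => by
    rw [hΘeq, image_eq_zero_of_notMem_tsupport hz]; simp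
  -- If `Θ z` left `T`, it would be a fixed point of `Θ`, and injectivity would give `Θ z = z ∈ T`.
  have hmaps : ∀ T, tsupport ρ ⊆ T → ∀ z ∈ T, Θ z ∈ T := by
    intro T hT z hz
    by_contra hn
    have h1 := Θ.injective (hfix _ fun hh => hn (hT hh))
    exact hn (by rwa [h1])
  have hΘA : ∀ z ∈ A, z ∈ G ∩ B → Θ z ∈ A := by
    intro z hz hzG
    rcases (hρr z).1.eq_or_lt with h0 | h0
    · rw [hΘeq, ← h0]
      simpa using hz
    · have := hmaps _ hρG z hzG
      rw [hΘeq] at this ⊢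
      exact _root_.interior_subset (hv z hz hzG.2 _ (by positivity) this.2)
  let f : M → M := fun y => if y ∈ W then inv (Θ (c.toFun y)) else y
  have hfW : ∀ y ∈ W, f y = inv (Θ (c.toFun y)) := fun y hy => if_pos hy
  have hΘW : ∀ y ∈ W, Θ (c.toFun y) ∈ A := fun y hy =>
    hΘA _ (mem_image_of_mem _ (hWc hy)) (hWG y hy)
  have hfc : ∀ y ∈ W, f y ∈ c.source := fun y hy => by rw [hfW y hy]; exact hinv_mem _ (hΘW y hy)
  have hcf : ∀ y ∈ W, c.toFun (f y) = Θ (c.toFun y) := fun y hy => by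
    rw [hfW y hy]; exact hinv_eq _ (hΘW y hy)
  have hff : ∀ y ∈ W, f y ∈ W := fun y hy => by
    rw [← hGW _ (hfc y hy), hcf y hy]
    exact (hmaps _ hρG _ (hWG y hy)).1
  have hfn : ∀ y ∉ W, f y = y := fun y hy => if_neg hy
  have hfQ : ∀ y, y ∉ c.source ∩ c.toFun ⁻¹' tsupport ρ → f y = y := by
    intro y hy
    by_cases hyW : y ∈ W
    · rw [hfW y hyW, hfix _ fun hh => hy ⟨hWc hyW, hh⟩, hinv y (hWc hyW)]
    · exact hfn y hyW
  have hQW : c.source ∩ c.toFun ⁻¹' tsupport ρ ⊆ W := fun y hy =>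
    (hGW y hy.1).1 (hρG hy.2).1
  -- Compact in a Hausdorff space, hence closed in all of `M` and not only in the chart domain: the
  -- extension by the identity is then continuous at the boundary of `W`.
  have hQ : IsClosed (c.source ∩ c.toFun ⁻¹' tsupport ρ) :=
    (c.isCompact_inter_preimage hZ).isClosed
  have hid : ∀ y ∉ W, id =ᶠ[𝓝 y] f := fun y hy => by
    filter_upwards [hQ.isOpen_compl.mem_nhds fun hh => hy (hQW hh)] with y' hy'
    exact (hfQ y' hy').symm
  have hfint : ∀ y ∈ W, 0 < ρ (c.toFun y) → f y ∈ K.interior := by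
    intro y hy hy0
    refine K.mem_interior hc (hfc y hy) ?_
    rw [← mem_interior_iff_mem_nhds, hcf y hy]
    have h1 := hmaps _ hρG _ (hWG y hy)
    rw [hΘeq] at h1 ⊢
    exact hv _ (mem_image_of_mem _ (hWc hy)) (hWG y hy).2 _ (by positivity) h1.2
  refine ⟨f, ⟨?_, ?_, ?_, hfn, fun y => ?_,
    fun y hy => hfint y (hsW hy) (by rw [hρs _ (mem_image_of_mem _ hy)]; exact one_pos)⟩, ?_⟩
  · refine continuous_iff_continuousAt.2 fun y => ?_
    by_cases hy : y ∈ W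
    · refine ContinuousOn.continuousAt (s := W) ?_ (hW.mem_nhds hy)
      exact c.continuousOn_of_comp hfc
        ((Θ.continuous.comp_continuousOn (c.continuousOn.mono hWc)).congr hcf)
    · exact continuousAt_id.congr (hid y hy)
  · intro y y' hyy'
    by_cases hy : y ∈ W <;> by_cases hy' : y' ∈ W
    · have h1 := congrArg c.toFun hyy'
      rw [hcf y hy, hcf y' hy'] at h1
      exact c.injOn (hWc hy) (hWc hy') (Θ.injective h1)
    · exact absurd (hfn y' hy' ▸ hyy' ▸ hff y hy) hy'
    · exact absurd (hfn y hy ▸ hyy'.symm ▸ hff y' hy') hy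
    · rwa [hfn y hy, hfn y' hy'] at hyy'
  · intro y
    by_cases hy : y ∈ W
    · refine ⟨c, hc, c, hc, hWc hy, hfc y hy, _, .of_homeomorph hΘ1 hΘ2, mem_univ _, ?_⟩
      filter_upwards [hW.mem_nhds hy] with y' hy'
      exact hcf y' hy'
    · exact IsLocalDiffeoAt.id.congr (hid y hy)
  · by_cases hy : y ∈ W
    · rcases (hρr (c.toFun y)).1.eq_or_lt with h0 | h0
      · left
        rw [hfW y hy, hΘeq, ← h0, mul_zero, zero_smul, add_zero, hinv y (hWc hy)]
      · exact Or.inr (hfint y hy h0)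
    · exact Or.inl (hfn y hy)
  · intro h hh y
    by_cases hy : y ∈ c.source ∩ c.toFun ⁻¹' tsupport ρ
    · have hyW := hQW hy
      have h1 := hεH h hh (c.toFun y) ⟨mem_image_of_mem _ hy.1, hy.2⟩ (Θ (c.toFun y))
        ⟨hΘW y hyW, hmaps _ subset_rfl _ hy.2⟩ (by
          rw [hΘeq, dist_eq_norm, add_sub_cancel_left, norm_smul, norm_mul,
            Real.norm_of_nonneg hε.le, Real.norm_of_nonneg (hρr _).1, mul_assoc]
          exact mul_le_mul_of_nonneg_left
            (mul_le_of_le_one_left (norm_nonneg v) (hρr _).2) hε.le)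
      rwa [hinv y hy.1, ← hfW y hyW] at h1
    · rw [hfQ y hy]
      linarith

end SmoothKinkStructure

/-! ### Ordered compositions and locally finite covers -/

theorem Finset.filter_sort_eq_sort {ι : Type*} [LinearOrder ι] {S T : Finset ι} (h : S ⊆ T) :
    T.sort.filter (· ∈ S) = S.sort := by
  refine List.Perm.eq_of_pairwise' (r := (· ≤ ·)) ((T.pairwise_sort _).filter _)
    (S.pairwise_sort _) ?_
  rw [List.perm_ext_iff_of_nodup ((T.sort_nodup _).filter _) (S.sort_nodup _)]
  intro a
  simp only [List.mem_filter, Finset.mem_sort, decide_eq_true_eq]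
  exact ⟨fun hh => hh.2, fun hh => ⟨h hh, hh⟩⟩

/-- In an ordered composition of maps each of which increases the height `h i` by at most one,
the maps that fix the sublevel set `W i` can be left out on the zero set of the height. -/
theorem foldr_sort_eq_of_height {ι X : Type*} [LinearOrder ι] {f : ι → X → X} {W : Set X}
    {S T : Finset ι} {h : X → ℝ} (hfix : ∀ k ∉ S, ∀ y ∈ W, f k y = y)
    (hW : ∀ y, h y ≤ S.card → y ∈ W) (hstep : ∀ k ∈ S, ∀ y, h (f k y) ≤ h y + 1)
    (hST : S ⊆ T) {x : X} (hx : h x ≤ 0) :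
    T.sort.foldr f x = S.sort.foldr f x ∧ T.sort.foldr f x ∈ W := by
  -- Only the steps with index in `S` can raise the height, so it stays at most `S.card`; hence the
  -- orbit stays in `W`, where the other maps act trivially.
  have key : ∀ L : List ι, L.Nodup → L.foldr f x = (L.filter (· ∈ S)).foldr f x ∧
      h (L.foldr f x) ≤ (L.filter (· ∈ S)).length ∧ L.foldr f x ∈ W := by
    intro L hL
    have hcard : ((L.filter (· ∈ S)).length : ℝ) ≤ S.card := by
      rw [← List.toFinset_card_of_nodup (hL.filter _)]
      exact_mod_cast Finset.card_le_card fun a ha => by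
        simpa using (List.mem_filter.1 (List.mem_toFinset.1 ha)).2
    have : L.foldr f x = (L.filter (· ∈ S)).foldr f x ∧
        h (L.foldr f x) ≤ (L.filter (· ∈ S)).length := by
      induction L with
      | nil => simpa using hx
      | cons a L ih =>
        have hL' := (List.nodup_cons.1 hL).2
        have hle : ((L.filter (· ∈ S)).length : ℝ) ≤ ((a :: L).filter (· ∈ S)).length := by
          exact_mod_cast ((List.sublist_cons_self a L).filter _).length_le
        obtain ⟨ih1, ih2⟩ := ih hL' (hle.trans hcard)
        by_cases ha : a ∈ S
        · simp only [List.foldr_cons, List.filter_cons, ha, decide_true, if_true, ← ih1,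
            List.length_cons, Nat.cast_add, Nat.cast_one, true_and]
          exact (hstep a ha _).trans (by linarith)
        · have hmem : L.foldr f x ∈ W := hW _ (ih2.trans (hle.trans hcard))
          simp only [List.foldr_cons, List.filter_cons, ha, hfix a ha _ hmem, decide_false,
            Bool.false_eq_true, if_false]
          exact ⟨ih1, ih2⟩
    exact ⟨this.1, this.2, hW _ (this.2.trans hcard)⟩
  obtain ⟨h1, -, h2⟩ := key T.sort (T.sort_nodup _)
  rw [Finset.filter_sort_eq_sort hST] at h1
  exact ⟨h1, h2⟩

/-- A space with a locally finite open cover by paracompact subspaces, which has a shrinking, is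
paracompact. -/
theorem paracompactSpace_of_locallyFinite {ι X : Type u} [TopologicalSpace X] {W O : ι → Set X}
    (hW : ∀ i, IsOpen (W i)) (hO : ∀ i, IsOpen (O i)) (hlf : LocallyFinite W)
    (hOW : ∀ i, closure (O i) ⊆ W i) (hcov : ⋃ i, O i = univ)
    (hp : ∀ i, ParacompactSpace (W i)) : ParacompactSpace X := by
  refine ⟨fun α s hs hsu => ?_⟩
  have h1 : ∀ i, ∃ v : α → Set (W i), (∀ a, IsOpen (v a)) ∧ ⋃ a, v a = univ ∧ LocallyFinite v ∧
      ∀ a, v a ⊆ Subtype.val ⁻¹' s a := fun i =>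
    precise_refinement (fun a => (Subtype.val ⁻¹' s a : Set (W i)))
      (fun a => (hs a).preimage continuous_subtype_val)
      (by rw [← preimage_iUnion, hsu, preimage_univ])
  choose v hvo hvu hvlf hvs using h1
  refine ⟨(_ : ι) × α, fun p => Subtype.val '' v p.1 p.2 ∩ O p.1, fun p => ?_, ?_, fun x => ?_,
    fun p => ⟨p.2, ?_⟩⟩
  · exact ((hW p.1).isOpenMap_subtype_val _ (hvo p.1 p.2)).inter (hO p.1)
  · refine iUnion_eq_univ_iff.2 fun x => ?_
    obtain ⟨i, hi⟩ := iUnion_eq_univ_iff.1 hcov x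
    obtain ⟨a, ha⟩ := iUnion_eq_univ_iff.1 (hvu i) ⟨x, hOW i (subset_closure hi)⟩
    exact ⟨⟨i, a⟩, ⟨_, ha, rfl⟩, hi⟩
  · obtain ⟨N, hN, hNfin⟩ := hlf x
    have h2 : ∀ i, ∃ N' ∈ 𝓝 x, {a | ((Subtype.val '' v i a ∩ O i) ∩ N').Nonempty}.Finite := by
      intro i
      by_cases hx : x ∈ W i
      · obtain ⟨N', hN', hfin⟩ := hvlf i ⟨x, hx⟩
        refine ⟨Subtype.val '' N', (hW i).isOpenMap_subtype_val.image_mem_nhds hN',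
          hfin.subset ?_⟩
        rintro a ⟨_, ⟨⟨y, hy, rfl⟩, -⟩, ⟨y', hy', hyy'⟩⟩
        exact ⟨y, hy, Subtype.ext hyy' ▸ hy'⟩
      -- Local finiteness inside `W i` says nothing at points outside it; there the shrinking
      -- provides a neighbourhood that misses every piece of index `i`.
      · refine ⟨(closure (O i))ᶜ, isClosed_closure.isOpen_compl.mem_nhds fun hx' => hx (hOW i hx'),
          finite_empty.subset ?_⟩
        rintro a ⟨y, ⟨-, hy⟩, hy'⟩
        exact hy' (subset_closure hy)
    choose N' hN' hfin using h2
    refine ⟨N ∩ ⋂ i ∈ {i | (W i ∩ N).Nonempty}, N' i,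
      Filter.inter_mem hN ((Filter.biInter_mem hNfin).2 fun i _ => hN' i),
      (hNfin.biUnion fun i _ => (hfin i).image (Sigma.mk i)).subset ?_⟩
    rintro ⟨i, a⟩ ⟨y, ⟨hyv, hyO⟩, hyN, hyN'⟩
    have hi : i ∈ {i | (W i ∩ N).Nonempty} := ⟨y, hOW i (subset_closure hyO), hyN⟩
    exact mem_biUnion hi ⟨a, ⟨y, ⟨hyv, hyO⟩, mem_iInter₂.1 hyN' i hi⟩, rfl⟩
  · rintro _ ⟨⟨y, hy, rfl⟩, -⟩
    exact hvs _ _ hy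

/-! ### The global push into the interior -/

namespace SmoothKinkStructure

variable {d : ℕ} [NeZero d] {M : Type*} [TopologicalSpace M] (K : SmoothKinkStructure d M)

variable {K} in
theorem foldr_isLocalDiffeoAt {ι : Type*} {f : ι → M → M} (hf : ∀ i, Continuous (f i))
    (hd : ∀ i y, K.IsLocalDiffeoAt (f i) y) (L : List ι) :
    Continuous (fun x => L.foldr f x) ∧ ∀ y, K.IsLocalDiffeoAt (fun x => L.foldr f x) y := by
  induction L with
  | nil => exact ⟨continuous_id, fun y => IsLocalDiffeoAt.id⟩
  | cons a L ih =>
    exact ⟨(hf a).comp ih.1, fun y =>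
      (hd a _).comp (ih.2 y) (hf a).continuousAt ih.1.continuousAt⟩

-- An orbit that enters the interior stays there. Otherwise every push fixes the point, which
-- therefore lies in none of the sets `s i`.
variable {K} in
theorem foldr_mem_interior {ι : Type*} {f : ι → M → M} {s W : ι → Set M}
    (hf : ∀ i, K.IsPush (s i) (W i) (f i)) (L : List ι) (x : M) :
    L.foldr f x ∈ K.interior ∨ L.foldr f x = x ∧ ∀ i ∈ L, x ∉ s i := by
  induction L with
  | nil => simp
  | cons a L ih =>
    rcases ih with ih | ⟨ih, ih'⟩
    · exact Or.inl (((hf a).isLocalDiffeoAt _).mem_interior (hf a).continuous.continuousAt ih)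
    · rw [List.foldr_cons, ih]
      by_cases hx : x ∈ s a
      · exact Or.inl ((hf a).mem_interior x hx)
      · rcases (hf a).eq_self_or_mem_interior x with h | h
        · refine Or.inr ⟨h, fun i hi => ?_⟩
          rcases List.mem_cons.1 hi with rfl | hi
          · exact hx
          · exact ih' i hi
        · exact Or.inl h

/-- A locally finite cover by relatively compact sets that admit pushes, and a shrinking of it. -/
theorem exists_push_cover [T2Space M] [ParacompactSpace M] : ∃ W O : M → Set M,
    (∀ i, IsOpen (W i)) ∧ (∀ i, IsOpen (O i)) ∧ LocallyFinite W ∧ ⋃ i, O i = univ ∧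
    (∀ i, closure (O i) ⊆ W i) ∧ (∀ i, IsCompact (closure (W i))) ∧
    (∀ i, ∃ c ∈ K.charts, W i ⊆ c.source) ∧
    ∀ i, ∀ H : Set (M → ℝ), H.Finite → (∀ h ∈ H, Continuous h) →
      ∃ f : M → M, K.IsPush (closure (O i)) (W i) f ∧ ∀ h ∈ H, ∀ y, h (f y) ≤ h y + 1 := by
  choose U hUo hxU hC hc hpush using K.exists_push
  obtain ⟨W, hWo, hWU, hWlf, hWsub⟩ := precise_refinement U hUo
    (iUnion_eq_univ_iff.2 fun x => ⟨x, hxU x⟩)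
  obtain ⟨O, hO, hOo, hOW⟩ := exists_iUnion_eq_closure_subset hWo hWlf.point_finite hWU
  have hWc : ∀ i, IsCompact (closure (W i)) := fun i => by
    obtain ⟨C, hC, hUC⟩ := hC i
    exact hC.of_isClosed_subset isClosed_closure
      (closure_minimal ((hWsub i).trans hUC) hC.isClosed)
  refine ⟨W, O, hWo, hOo, hWlf, hO, hOW, hWc, fun i => ?_, fun i H hH hHc => ?_⟩
  · obtain ⟨c, hc, hUc⟩ := hc i
    exact ⟨c, hc, (hWsub i).trans hUc⟩
  · exact hpush i _ _ ((hWc i).of_isClosed_subset isClosed_closure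
      ((hOW i).trans subset_closure)) (hWo i) (hOW i) (hWsub i) H hH hHc 1 one_pos

theorem exists_isClosedEmbedding_interior [T2Space M] [ParacompactSpace M] :
    ∃ F : M → M, IsClosedEmbedding F ∧ (∀ x, K.IsLocalDiffeoAt F x) ∧ ∀ x, F x ∈ K.interior := by
  classical
  obtain ⟨W, O, hWo, hOo, hWlf, hO, hOW, hWc, -, hpush⟩ := K.exists_push_cover
  let _ : LinearOrder M := linearOrderOfSTO WellOrderingRel
  have hfin : ∀ i, {k | (W k ∩ W i).Nonempty}.Finite := fun i =>
    (hWlf.finite_nonempty_inter_compact (hWc i)).subset fun k hk =>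
      hk.mono (inter_subset_inter_right _ subset_closure)
  let S : M → Finset M := fun i => (hfin i).toFinset
  have hS : ∀ i k, k ∈ S i ↔ (W k ∩ W i).Nonempty := fun i k => (hfin i).mem_toFinset
  have hS' : ∀ i k, k ∈ S i ↔ i ∈ S k := fun i k => by rw [hS, hS, inter_comm]
  have hh : ∀ i, ∃ h : M → ℝ, Continuous h ∧ (∀ x ∈ closure (O i), h x ≤ 0) ∧
      ∀ x, h x ≤ (S i).card → x ∈ W i := by
    intro i
    obtain ⟨g, hg0, hg1, -⟩ := exists_continuous_zero_one_of_isClosed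
      (isClosed_closure (s := O i)) (hWo i).isClosed_compl
      (disjoint_compl_right_iff_subset.2 (hOW i))
    -- The height exceeds `(S i).card` off `W i`, so as many unit steps as `S i` has elements cannot
    -- lead from `closure (O i)` out of `W i`.
    refine ⟨fun x => ((S i).card + 1) * g x, by fun_prop, fun x hx => ?_, fun x hx => ?_⟩
    · simp [hg0 hx]
    · by_contra hxW
      have : g x = 1 := hg1 hxW
      simp only [this] at hx
      linarith
  choose h hhc hh0 hhW using hh
  -- The push `f k` must respect `h i` whenever `k ∈ S i`. By symmetry this means `i ∈ S k`, a
  -- finite set of conditions.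
  choose f hf hfh using fun k => hpush k (h '' S k) ((S k).finite_toSet.image h)
    (by rintro _ ⟨i, -, rfl⟩; exact hhc i)
  have hstep : ∀ i, ∀ k ∈ S i, ∀ y, h i (f k y) ≤ h i y + 1 := fun i k hk =>
    hfh k _ (mem_image_of_mem h ((hS' i k).1 hk))
  have hfix : ∀ i, ∀ k ∉ S i, ∀ y ∈ W i, f k y = y := fun i k hk y hy =>
    (hf k).eq_self y fun hy' => hk ((hS i k).2 ⟨y, hy', hy⟩)
  have key : ∀ i T, S i ⊆ T → ∀ x ∈ closure (O i),
      T.sort.foldr f x = (S i).sort.foldr f x ∧ T.sort.foldr f x ∈ W i := fun i T hT x hx =>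
    foldr_sort_eq_of_height (hfix i) (hhW i) (hstep i) hT (hh0 i x hx)
  choose a ha using fun x => mem_iUnion.1 (hO.symm ▸ mem_univ x : x ∈ ⋃ i, O i)
  let F : M → M := fun x => (S (a x)).sort.foldr f x
  have hF : ∀ i T, S i ⊆ T → ∀ x ∈ closure (O i), F x = T.sort.foldr f x := by
    intro i T hT x hx
    have h1 := key (a x) (S (a x) ∪ T) Finset.subset_union_left x (subset_closure (ha x))
    have h2 := key i (S (a x) ∪ T) (hT.trans Finset.subset_union_right) x hx
    rw [(key i T hT x hx).1, ← h2.1, h1.1]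
  have hFO : ∀ x, F =ᶠ[𝓝 x] fun y => (S (a x)).sort.foldr f y := fun x => by
    filter_upwards [(hOo (a x)).mem_nhds (ha x)] with y hy
    exact hF (a x) _ subset_rfl y (subset_closure hy)
  have hfold := foldr_isLocalDiffeoAt (K := K) (fun i => (hf i).continuous)
    fun i => (hf i).isLocalDiffeoAt
  have hFc : Continuous F := continuous_iff_continuousAt.2 fun x =>
    (hfold _).1.continuousAt.congr (hFO x).symm
  have hinj : ∀ L : List M, Function.Injective fun x => L.foldr f x := fun L => by
    induction L with
    | nil => exact Function.injective_id
    | cons k L ih => exact (hf k).injective.comp ih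
  refine ⟨F, .of_continuous_injective_isClosedMap hFc ?_ ?_, ?_, ?_⟩
  · intro x y hxy
    -- Over the union of the two index sets, both values come from one finite composition of
    -- injective maps.
    rw [hF (a x) (S (a x) ∪ S (a y)) Finset.subset_union_left x (subset_closure (ha x)),
      hF (a y) (S (a x) ∪ S (a y)) Finset.subset_union_right y (subset_closure (ha y))] at hxy
    exact hinj _ hxy
  · intro Z hZ
    have h1 : F '' Z = ⋃ i, F '' (Z ∩ closure (O i)) := by
      rw [← image_iUnion, ← inter_iUnion, iUnion_eq_univ_iff.2
        fun x => ⟨a x, subset_closure (ha x)⟩, inter_univ]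
    rw [h1]
    -- The image of `closure (O i)` stays in `W i`, so the pieces are locally finite; each one is
    -- compact.
    refine LocallyFinite.isClosed_iUnion (hWlf.subset fun i => ?_) fun i => ?_
    · rintro _ ⟨x, ⟨-, hx⟩, rfl⟩
      rw [hF i _ subset_rfl x hx]
      exact (key i _ subset_rfl x hx).2
    · have : IsCompact (closure (O i)) := (hWc i).of_isClosed_subset isClosed_closure
        ((hOW i).trans subset_closure)
      exact ((this.inter_left hZ).image hFc).isClosed
  · exact fun x => ((hfold _).2 x).congr (hFO x).symm
  · intro x
    rcases foldr_mem_interior hf (S (a x)).sort x with h1 | ⟨-, h1⟩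
    · exact h1
    · refine absurd (subset_closure (ha x)) (h1 (a x) ?_)
      rw [Finset.mem_sort, hS, inter_self]
      exact ⟨x, hOW _ (subset_closure (ha x))⟩

end SmoothKinkStructure

/-! ### The interior as ambient manifold -/

namespace EucChart

variable {d : ℕ} {M : Type*} [TopologicalSpace M]

/-- An interior chart as a homeomorphism between open sets. -/
noncomputable def IsInteriorChart.toOpenPartialHomeomorph [Nonempty M] {c : EucChart d M}
    (hc : c.IsInteriorChart) : OpenPartialHomeomorph M (Euc d) :=
  OpenPartialHomeomorph.ofContinuousOpenRestrict (c.injOn.toPartialEquiv c.toFun c.source)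
    c.continuousOn (fun U hU => by
      obtain ⟨W, hW, rfl⟩ := hU
      change IsOpen (c.source.domRestrict c.toFun '' (Subtype.val ⁻¹' W))
      rw [image_domRestrict]
      exact hc.isOpen_image (hW.inter c.open_source) inter_subset_right) c.open_source

/-- The restriction of a chart to a subspace. -/
def comap (c : EucChart d M) {X : Type*} [TopologicalSpace X] {j : X → M} (hj : IsEmbedding j) :
    EucChart d X where
  source := j ⁻¹' c.source
  toFun := c.toFun ∘ j
  open_source := c.open_source.preimage hj.continuous
  isEmbedding_restrict := by
    have h : IsEmbedding ((j ⁻¹' c.source).domRestrict j) := hj.comp IsEmbedding.subtypeVal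
    exact c.isEmbedding_restrict.comp (h.codRestrict c.source fun x => x.2)

theorem IsInteriorChart.comap {c : EucChart d M} (hc : c.IsInteriorChart) {X : Type*}
    [TopologicalSpace X] {j : X → M} (hj : IsEmbedding j) (hcj : c.source ⊆ range j) :
    (c.comap hj).IsInteriorChart := by
  have : (c.toFun ∘ j) '' (j ⁻¹' c.source) = c.toFun '' c.source := by
    rw [image_comp, image_preimage_eq_of_subset hcj]
  change IsOpen ((c.toFun ∘ j) '' (j ⁻¹' c.source))
  rw [this]
  exact hc

theorem IsInteriorChart.restrComp {c : EucChart d M} (hc : c.IsInteriorChart) {V : Set M}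
    (hV : IsOpen V) (hVc : V ⊆ c.source) {Ψ : OpenPartialHomeomorph (Euc d) (Euc d)}
    (hΨ : MapsTo c.toFun V Ψ.source) : (c.restrComp V hV hVc Ψ hΨ).IsInteriorChart := by
  change IsOpen ((Ψ ∘ c.toFun) '' V)
  rw [image_comp]
  exact Ψ.isOpen_image_of_subset_source (hc.isOpen_image hV hVc) hΨ.image_subset

theorem IsBorderChartAt.restrComp_addRight [NeZero d] {c : EucChart d M} {x : M}
    (hc : c.IsBorderChartAt x) {V : Set M} (hV : IsOpen V) (hVc : V ⊆ c.source) (hx : x ∈ V)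
    (a : Euc d) : (c.restrComp V hV hVc (Homeomorph.addRight a).toOpenPartialHomeomorph
      (mapsTo_univ _ _)).IsBorderChartAt x := by
  refine ⟨hx, ?_, ?_⟩
  · have h1 : IsEmbedding ((closure V).domRestrict c.toFun) :=
      hc.2.1.comp (IsEmbedding.inclusion (closure_mono hVc))
    exact (Homeomorph.addRight a).isEmbedding.comp h1
  · change IsC0BorderPoint (((fun z => z + a) ∘ c.toFun) '' V) (c.toFun x + a)
    rw [image_comp]
    obtain ⟨G, hG, h⟩ := c.exists_isOpen_mem_iff hV
    refine (hc.2.2.congr hG ((h x hc.1).2 hx) ?_).translate a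
    ext z
    constructor
    · rintro ⟨⟨y, hy, rfl⟩, hz⟩
      exact ⟨⟨y, (h y hy).1 hz, rfl⟩, hz⟩
    · rintro ⟨⟨y, hy, rfl⟩, hz⟩
      exact ⟨⟨y, hVc hy, rfl⟩, hz⟩

end EucChart

namespace SmoothKinkStructure

variable {d : ℕ} [NeZero d] {M : Type u} [TopologicalSpace M] (K : SmoothKinkStructure d M)

theorem source_subset_interior {c : EucChart d M} (hc : c ∈ K.charts) (hci : c.IsInteriorChart) :
    c.source ⊆ K.interior := fun _ hx => ⟨c, hc, hx, hci⟩

/-- The charts of the interior with values in the half-space: interior charts followed by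
`expFirst`. -/
def interiorAtlas : Set (OpenPartialHomeomorph K.interior (EuclideanHalfSpace d)) :=
  {f | ∃ c ∈ K.charts, c.IsInteriorChart ∧ f.source = Subtype.val ⁻¹' c.source ∧
    ∀ x ∈ f.source, (f x).1 = expFirst d (c.toFun x.1)}

theorem exists_mem_interiorAtlas (x : K.interior) : ∃ f ∈ K.interiorAtlas, x ∈ f.source := by
  obtain ⟨c, hc, hx, hci⟩ := x.2
  have : Nonempty K.interior := ⟨x⟩
  let g := (hci.comap (IsEmbedding.subtypeVal (p := (· ∈ K.interior))) (by
    rw [Subtype.range_coe]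
    exact K.source_subset_interior hc hci)).toOpenPartialHomeomorph
  have hg : (g.trans (expFirstHalfSpace d)).source = Subtype.val ⁻¹' c.source := by
    rw [OpenPartialHomeomorph.trans_source]
    exact inter_univ _
  exact ⟨g.trans (expFirstHalfSpace d), ⟨c, hc, hci, hg, fun _ _ => rfl⟩, hg ▸ hx⟩

noncomputable instance : ChartedSpace (EuclideanHalfSpace d) K.interior where
  atlas := K.interiorAtlas
  chartAt x := (K.exists_mem_interiorAtlas x).choose
  mem_chart_source x := (K.exists_mem_interiorAtlas x).choose_spec.2
  chart_mem_atlas x := (K.exists_mem_interiorAtlas x).choose_spec.1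

/-- Transition maps of these charts are those of `M` conjugated by `expFirst`, hence smooth on open
subsets of `ℝᵈ`. -/
instance : IsManifold (𝓡∂ d) ∞ K.interior := by
  refine isManifold_of_contDiffOn _ _ _ ?_
  rintro f f' ⟨c, hc, -, hf, hfc⟩ ⟨c', hc', -, hf', hfc'⟩
  obtain ⟨Φ, hΦ, h⟩ := K.exists_transition hc hc'
  have hT := (isDiffeo_expFirst (d := d).symm.trans hΦ).trans isDiffeo_expFirst
  have key : ∀ z ∈ (𝓡∂ d).symm ⁻¹' (f.symm.trans f').source ∩ range (𝓡∂ d),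
      z ∈ (((expFirst d).symm.trans Φ).trans (expFirst d)).source ∧
      (𝓡∂ d) (f' (f.symm ((𝓡∂ d).symm z))) =
        (((expFirst d).symm.trans Φ).trans (expFirst d)) z := by
    rintro _ ⟨hz, w, rfl⟩
    rw [mem_preimage, ModelWithCorners.left_inv, OpenPartialHomeomorph.trans_source] at hz
    rw [ModelWithCorners.left_inv]
    have hy : f.symm w ∈ f.source := f.map_target hz.1
    have hy' : f.symm w ∈ f'.source := hz.2
    have h1 : (𝓡∂ d) w = expFirst d (c.toFun (f.symm w).1) := by
      rw [← hfc _ hy, f.right_inv hz.1]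
      rfl
    have h2 : (expFirst d).symm ((𝓡∂ d) w) = c.toFun (f.symm w).1 := by
      rw [h1]
      exact (expFirst d).left_inv (mem_univ _)
    obtain ⟨h3, h4⟩ := h (f.symm w).1 (hf.subset hy) (hf'.subset hy')
    constructor
    · simp only [OpenPartialHomeomorph.trans_source, mem_inter_iff, mem_preimage]
      refine ⟨⟨?_, ?_⟩, mem_univ _⟩
      · rw [h1]
        exact expFirst_pos _
      · rw [h2]
        exact h3
    · simp only [OpenPartialHomeomorph.coe_trans, Function.comp_apply]
      rw [h2, h4]
      exact hfc' _ hy'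
  exact (hT.1.mono fun z hz => (key z hz).1).congr fun z hz => (key z hz).2

theorem isInteriorPoint (x : K.interior) : (𝓡∂ d).IsInteriorPoint x := by
  obtain ⟨c, -, -, -, h⟩ := chart_mem_atlas (EuclideanHalfSpace d) x
  change extChartAt (𝓡∂ d) x x ∈ _
  rw [interior_range_modelWithCornersEuclideanHalfSpace]
  change 0 < (chartAt (EuclideanHalfSpace d) x x).1 0
  rw [h x (mem_chart_source _ x)]
  exact expFirst_pos _

theorem comap_smoothlyCompatible {c : EucChart d M} (hc : c ∈ K.charts)
    {f : OpenPartialHomeomorph K.interior (EuclideanHalfSpace d)}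
    (hf : f ∈ atlas (EuclideanHalfSpace d) K.interior) :
    (c.comap (IsEmbedding.subtypeVal (p := (· ∈ K.interior)))).SmoothlyCompatible
      (EucChart.ofHalfSpace f) := by
  obtain ⟨c', hc', -, hf', hfc'⟩ := hf
  obtain ⟨Φ, hΦ, h⟩ := K.exists_transition hc hc'
  obtain ⟨h1, h2⟩ := hΦ.trans (isDiffeo_expFirst (d := d))
  refine ⟨_, h1, h2, ?_, ?_⟩
  · rintro _ ⟨x, ⟨hx, hx'⟩, rfl⟩
    rw [OpenPartialHomeomorph.trans_source]
    exact ⟨(h x.1 hx (hf'.subset hx')).1, mem_univ _⟩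
  · rintro x ⟨hx, hx'⟩
    have h3 := (h x.1 hx (hf'.subset hx')).2
    change expFirst d (Φ (c.toFun x.1)) = (f x).1
    rw [h3, hfc' x hx']

/-- Paracompactness does not pass to open subspaces in general, but metrizability does. Each `W i`
lies in a chart domain, so its trace on the interior embeds into `ℝᵈ` and is metrizable; the locally
finite cover then glues the pieces. -/
theorem paracompactSpace_interior [T2Space M] [ParacompactSpace M] :
    ParacompactSpace K.interior := by
  obtain ⟨W, O, hWo, hOo, hWlf, hO, hOW, -, hc, -⟩ := K.exists_push_cover
  refine paracompactSpace_of_locallyFinite (W := fun i => Subtype.val ⁻¹' W i)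
    (O := fun i => Subtype.val ⁻¹' O i) (fun i => (hWo i).preimage continuous_subtype_val)
    (fun i => (hOo i).preimage continuous_subtype_val)
    (hWlf.preimage_continuous continuous_subtype_val)
    (fun i => (continuous_subtype_val.closure_preimage_subset _).trans (preimage_mono (hOW i)))
    (by rw [← preimage_iUnion, hO, preimage_univ]) fun i => ?_
  obtain ⟨c, -, hcW⟩ := hc i
  have h1 : IsEmbedding (fun x : (Subtype.val ⁻¹' W i : Set K.interior) => x.1.1) :=
    IsEmbedding.subtypeVal.comp IsEmbedding.subtypeVal
  have h2 := c.isEmbedding_restrict.comp (h1.codRestrict c.source fun x => hcW x.2)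
  have := h2.metrizableSpace
  let _ := TopologicalSpace.metrizableSpaceMetric (Subtype.val ⁻¹' W i : Set K.interior)
  infer_instance

-- The slice chart is an interior chart at `F p` followed by `Ψ⁻¹` and a translation. In it `F`
-- reads as the original chart `c₀` centred at `p`, so the kinks need only be invariant under
-- translation and restriction.
variable {K} in
theorem isSmoothSubmanifoldWithKinks_interior {F : M → M} (hF : IsEmbedding F)
    (hFd : ∀ x, K.IsLocalDiffeoAt F x) (hFi : ∀ x, F x ∈ K.interior) :
    IsSmoothSubmanifoldWithKinks le_rfl K (codRestrict F K.interior hFi) := by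
  have hj : IsEmbedding (codRestrict F K.interior hFi) := hF.codRestrict _ hFi
  refine ⟨hj, fun p => ?_⟩
  obtain ⟨c₀, hc₀, hp⟩ := K.maximal.prop.covers p
  have hp₀ : p ∈ c₀.source := hp.elim (fun h => h.1) fun h => h.1
  obtain ⟨c₁, hc₁, hp₁, hci₁⟩ := hFi p
  obtain ⟨Ψ, hΨ, hpΨ, he⟩ := (hFd p).exists_of_mem hF.continuous.continuousAt hc₀ hc₁ hp₀ hp₁
  have hnhds : ∀ᶠ y in 𝓝 p, c₁.toFun (F y) = Ψ (c₀.toFun y) ∧ y ∈ c₀.source ∧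
      F y ∈ c₁.source ∧ c₀.toFun y ∈ Ψ.source := by
    filter_upwards [he, c₀.open_source.mem_nhds hp₀,
      hF.continuous.continuousAt (c₁.open_source.mem_nhds hp₁),
      c₀.continuousAt hp₀ (Ψ.open_source.mem_nhds hpΨ)] with y h3 h4 h5 h6
    exact ⟨h3, h4, h5, h6⟩
  obtain ⟨V, hV, hVo, hpV⟩ := mem_nhds_iff.1 hnhds
  have hVc : V ⊆ c₀.source := fun y hy => (hV hy).2.1
  -- Because `F` is an embedding, the chart domain can be cut down to meet the image only in points
  -- coming from `V`, excluding distant sheets of `M`.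
  obtain ⟨O, hO, hOV⟩ := hj.isInducing.isOpen_iff.1 hVo
  let T := (Homeomorph.addRight (-c₀.toFun p)).toOpenPartialHomeomorph
  let c₁' := c₁.comap (IsEmbedding.subtypeVal (p := (· ∈ K.interior)))
  let S := (c₁'.source ∩ c₁'.toFun ⁻¹' Ψ.target) ∩ O
  have hS : IsOpen S :=
    (c₁'.continuousOn.isOpen_inter_preimage c₁'.open_source Ψ.open_target).inter hO
  have hSc : S ⊆ c₁'.source := fun x hx => hx.1.1
  have hST : MapsTo c₁'.toFun S (Ψ.symm.trans T).source := fun x hx => by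
    rw [OpenPartialHomeomorph.trans_source]
    exact ⟨hx.1.2, mem_univ _⟩
  let e := c₁'.restrComp S hS hSc (Ψ.symm.trans T) hST
  let c := c₀.restrComp V hVo hVc T (mapsTo_univ _ _)
  have hsource : V = codRestrict F K.interior hFi ⁻¹' S := by
    refine subset_antisymm (fun y hy => ⟨⟨(hV hy).2.2.1, ?_⟩, hOV.symm.subset hy⟩)
      fun y hy => hOV ▸ hy.2
    change c₁.toFun (F y) ∈ Ψ.target
    rw [(hV hy).1]
    exact Ψ.map_source (hV hy).2.2.2
  have htoFun : ∀ y ∈ V, e.toFun (codRestrict F K.interior hFi y) = c.toFun y := fun y hy => by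
    change T (Ψ.symm (c₁.toFun (F y))) = T (c₀.toFun y)
    rw [(hV hy).1, Ψ.left_inv (hV hy).2.2.2]
  have hcp : c.toFun p = 0 := add_neg_cancel (c₀.toFun p)
  have hcb : c.IsInteriorChart ∨ c.IsBorderChartAt p :=
    hp.imp (fun h => h.2.restrComp _ _ _) fun h => h.restrComp_addRight _ _ hpV _
  have hproj : ∀ z : Euc d, Euc.proj le_rfl z = z := fun z => rfl
  have himage : (fun x => Euc.proj le_rfl (e.toFun x)) ''
      (e.source ∩ range (codRestrict F K.interior hFi)) = c.toFun '' c.source := by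
    ext z
    constructor
    · rintro ⟨_, ⟨hx, y, rfl⟩, rfl⟩
      have hy : y ∈ V := hsource ▸ hx
      exact ⟨y, hy, (htoFun y hy).symm⟩
    · rintro ⟨y, hy, rfl⟩
      have hy' : y ∈ codRestrict F K.interior hFi ⁻¹' S := hsource ▸ hy
      exact ⟨_, ⟨hy', mem_range_self y⟩, htoFun y hy⟩
  refine ⟨e, ⟨Or.inl ?_, fun f hf => ?_⟩, ⟨?_, ?_, ?_, ?_⟩, c, ?_, hsource, ?_⟩
  · refine EucChart.IsInteriorChart.restrComp (hci₁.comap _ ?_) _ _ _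
    rw [Subtype.range_coe]
    exact K.source_subset_interior hc₁ hci₁
  · exact (K.comap_smoothlyCompatible hc₁ hf).restrComp _ _ _ (hΨ.symm.trans (.addRight _))
  · have : p ∈ codRestrict F K.interior hFi ⁻¹' S := hsource ▸ hpV
    exact this
  · rw [htoFun p hpV, hcp]
  · intro x _ i hi
    exact absurd i.2 (not_lt.2 hi)
  · rw [himage, ← hcp]
    refine hcb.imp (fun h => ?_) fun h => h.2.2
    rw [h.interior_eq]
    exact mem_image_of_mem _ hpV
  · exact K.mem_charts (hcb.imp_right fun h => ⟨p, h⟩) fun c' hc' =>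
      (K.maximal.prop.compatible c₀ hc₀ c' hc').restrComp _ _ _ (.addRight _)
  · exact fun y hy => (htoFun y hy).symm

end SmoothKinkStructure

theorem mainTheorem7 {d : ℕ} [NeZero d] {M : Type u} [TopologicalSpace M] [T2Space M]
    [ParacompactSpace M] (K : SmoothKinkStructure d M) :
    ∃ (N : Type u) (_ : TopologicalSpace N) (_ : T2Space N) (_ : ParacompactSpace N)
      (_ : ChartedSpace (EuclideanHalfSpace d) N) (_ : IsManifold (𝓡∂ d) ∞ N) (j : M → N),
      IsSmoothSubmanifoldWithKinks le_rfl K j ∧ range j ⊆ (𝓡∂ d).interior N := by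
  obtain ⟨F, hF, hFd, hFi⟩ := K.exists_isClosedEmbedding_interior
  exact ⟨K.interior, inferInstance, inferInstance, K.paracompactSpace_interior, inferInstance,
    inferInstance, _, K.isSmoothSubmanifoldWithKinks_interior hF.isEmbedding hFd hFi,
    fun x _ => K.isInteriorPoint x⟩
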